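/- All operads live in the category of sets. A cyclic operad $\mathcal C$ is a functor $S\mapsto \mathcal C(S)$ from finite sets and bijections to sets, with operations $${}_a\circ_b:\mathcal C(S\sqcup\{a\})\times\mathcal C(T\sqcup\{b\})\to\mathcal C(S\sqcup T)$$ that are equivariant, commutative ($x\,{}_a\circ_b\,y=y\,{}_b\circ_a\,x$) and associative; no operadic unit is required. Let $\mathbb S$ be a commutative monoid containing $\mathbb N=\{0,1,2,\dots\}$ (for instance $\mathbb N$ or $\frac12\mathbb N$). A modular operad $\mathcal M$ is a cyclic operad whose components are disjoint unions $\mathcal M(S)=\bigsqcup_{G\in\mathbb S}\mathcal M(S;G)$, where $G$ is invariant under relabelling and additive under ${}_a\circ_b$, together with equivariant contractions $\circ_{uv}=\circ_{vu}:\mathcal M(S\sqcup\{u,v\};G)\to\mathcal M(S;G+1)$ that commute with each other and satisfy the interchange laws $$\circ_{ab}(x\,{}_c\circ_d\,y)=\circ_{cd}(x\,{}_a\circ_b\,y),\qquad \circ_{cd}(x)\,{}_a\circ_b\,y=\circ_{cd}(x\,{}_a\circ_b\,y),$$ where in the first law $a\neq c$ are inputs of $x$ and $b\neq d$ are inputs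 of $y$, and in the second law $a,c,d$ are distinct inputs of $x$ and $b$ is an input of $y$. The modular completion $\mathrm{Mod}$ is the left adjoint of the functor $\square$ that sends a modular operad to its genus zero part, regarded as a cyclic operad. **Proposition.** Let $\mathcal B\subset\mathcal C$ be a cyclic suboperad of a cyclic operad $\mathcal C$. Assume that for all finite sets $R,S$, all distinct labels $p',q'$, $p'',q''$, and all $w'\in\mathcal C(\{p',q'\}\sqcup R)$ and $w''\in\mathcal C(\{p'',q''\}\sqcup S)$ such that $w'\,{}_{q'}\circ_{q''}\,w''\in\mathcal B(\{p',p''\}\sqcup R\sqcup S)$, at least one of the following holds: (i) there is a bijection $\rho:\{p',p''\}\sqcup R\sqcup S\to\{q',q''\}\sqcup R\sqcup S$ that fixes every element of $R\sqcup S$ and satisfies $w'\,{}_{p'}\circ_{p''}\,w''=\rho\,(w'\,{}_{q'}\circ_{q''}\,w'')$; (ii) there are $w_1'\in\mathcal B(\{p',q'\}\sqcup R)$ and $w_1''\in\mathcal B(\{p'',q''\}\sqcup S)$ such that $$w'\,{}_{p'}\circ_{p''}\,w''=w_1'\,{}_{p'}\circ_{p''}\,w_1''\quad\text{and}\quad w'\,{}_{q'}\circ_{q''}\,w''=w_1'\,{}_{q'}\circ_{q''}\,w_1''.$$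 Then the induced map $\varpi:\mathrm{Mod}(\mathcal B)\to\mathrm{Mod}(\mathcal C)$ is injective, that is, for every finite set $S$ the map $\mathrm{Mod}(\mathcal B)(S)\to\mathrm{Mod}(\mathcal C)(S)$ is injective. -/

import Mathlib

universe u v w

/-- The finite set `S` with the label `a` removed. -/
abbrev Rest {S : Type} (a : S) : Type := {x : S // x ≠ a}

/-- The finite set `S` with the labels `a` and `b` removed. -/
abbrev Rest₂ {S : Type} (a b : S) : Type := {x : S // x ≠ a ∧ x ≠ b}

namespace Relabel

/-! The canonical bijections between label sets. Each of them sends every label to itself;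
they occur because the two sides of an axiom describe the same set of labels differently. -/

variable {S T U : Type}

/-- The restriction of a bijection to the complements of a label and of its image. -/
def rest (σ : S ≃ T) (a : S) : Rest a ≃ Rest (σ a) :=
  σ.subtypeEquiv (fun _ => by simp)

/-- The restriction of a bijection to the complements of two labels and of their images. -/
def rest₂ (σ : S ≃ T) (a b : S) : Rest₂ a b ≃ Rest₂ (σ a) (σ b) :=
  σ.subtypeEquiv (fun _ => by simp)

def rest₂Comm (a b : S) : Rest₂ a b ≃ Rest₂ b a :=
  Equiv.subtypeEquivRight (fun _ => and_comm)

/-- Labels of `(x ∘_{ab} y) ∘_{cd} z` and of `x ∘_{ab} (y ∘_{cd} z)`. -/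
def assoc (a : S) (b c : T) (d : U) (h : b ≠ c) :
    Rest (Sum.inr ⟨c, h.symm⟩ : Rest a ⊕ Rest b) ⊕ Rest d ≃
      Rest a ⊕ Rest (Sum.inl ⟨b, h⟩ : Rest c ⊕ Rest d) where
  toFun
    | .inl ⟨.inl x, _⟩ => .inl x
    | .inl ⟨.inr y, hy⟩ =>
        .inr ⟨.inl ⟨y.1, fun e => hy (congrArg Sum.inr (Subtype.ext e))⟩,
          fun e => y.2 (congrArg Subtype.val (Sum.inl.inj e))⟩
    | .inr z => .inr ⟨.inr z, Sum.inr_ne_inl⟩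
  invFun
    | .inl x => .inl ⟨.inl x, Sum.inl_ne_inr⟩
    | .inr ⟨.inl y, hy⟩ =>
        .inl ⟨.inr ⟨y.1, fun e => hy (congrArg Sum.inl (Subtype.ext e))⟩,
          fun e => y.2 (congrArg Subtype.val (Sum.inr.inj e))⟩
    | .inr ⟨.inr z, _⟩ => .inr z
  left_inv := by rintro (⟨x | y, h⟩ | z) <;> rfl
  right_inv := by rintro (x | ⟨y | z, h⟩) <;> rfl

/-- Labels of `∘_{cd} ∘_{ab} x` and of `∘_{ab} ∘_{cd} x`. -/
def contrContr (a b c d : S) (hca : c ≠ a) (hcb : c ≠ b) (hda : d ≠ a) (hdb : d ≠ b) :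
    Rest₂ (⟨c, hca, hcb⟩ : Rest₂ a b) ⟨d, hda, hdb⟩ ≃
      Rest₂ (⟨a, hca.symm, hda.symm⟩ : Rest₂ c d) ⟨b, hcb.symm, hdb.symm⟩ where
  toFun x := ⟨⟨x.1.1, fun e => x.2.1 (Subtype.ext e), fun e => x.2.2 (Subtype.ext e)⟩,
    fun e => x.1.2.1 (congrArg Subtype.val e), fun e => x.1.2.2 (congrArg Subtype.val e)⟩
  invFun x := ⟨⟨x.1.1, fun e => x.2.1 (Subtype.ext e), fun e => x.2.2 (Subtype.ext e)⟩,
    fun e => x.1.2.1 (congrArg Subtype.val e), fun e => x.1.2.2 (congrArg Subtype.val e)⟩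
  left_inv _ := rfl
  right_inv _ := rfl

/-- Labels of `∘_{ab} (x ∘_{cd} y)` and of `∘_{cd} (x ∘_{ab} y)`, where `a, c` are labels of `x`
and `b, d` are labels of `y`. -/
def interchange (a c : S) (b d : T) (hac : a ≠ c) (hbd : b ≠ d) :
    Rest₂ (Sum.inl ⟨a, hac⟩ : Rest c ⊕ Rest d) (Sum.inr ⟨b, hbd⟩) ≃
      Rest₂ (Sum.inl ⟨c, hac.symm⟩ : Rest a ⊕ Rest b) (Sum.inr ⟨d, hbd.symm⟩) where
  toFun
    | ⟨.inl x, hx⟩ => ⟨.inl ⟨x.1, fun e => hx.1 (congrArg Sum.inl (Subtype.ext e))⟩,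
        fun e => x.2 (congrArg Subtype.val (Sum.inl.inj e)), Sum.inl_ne_inr⟩
    | ⟨.inr y, hy⟩ => ⟨.inr ⟨y.1, fun e => hy.2 (congrArg Sum.inr (Subtype.ext e))⟩,
        Sum.inr_ne_inl, fun e => y.2 (congrArg Subtype.val (Sum.inr.inj e))⟩
  invFun
    | ⟨.inl x, hx⟩ => ⟨.inl ⟨x.1, fun e => hx.1 (congrArg Sum.inl (Subtype.ext e))⟩,
        fun e => x.2 (congrArg Subtype.val (Sum.inl.inj e)), Sum.inl_ne_inr⟩
    | ⟨.inr y, hy⟩ => ⟨.inr ⟨y.1, fun e => hy.2 (congrArg Sum.inr (Subtype.ext e))⟩,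
        Sum.inr_ne_inl, fun e => y.2 (congrArg Subtype.val (Sum.inr.inj e))⟩
  left_inv := by rintro ⟨x | y, h⟩ <;> rfl
  right_inv := by rintro ⟨x | y, h⟩ <;> rfl

/-- Labels of `∘_{cd} (x) ∘_{ab} y` and of `∘_{cd} (x ∘_{ab} y)`, where `a, c, d` are labels
of `x` and `b` is a label of `y`. -/
def contrComp (a c d : S) (b : T) (hac : a ≠ c) (had : a ≠ d) :
    Rest (⟨a, hac, had⟩ : Rest₂ c d) ⊕ Rest b ≃
      Rest₂ (Sum.inl ⟨c, hac.symm⟩ : Rest a ⊕ Rest b) (Sum.inl ⟨d, had.symm⟩) where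
  toFun
    | .inl x => ⟨.inl ⟨x.1.1, fun e => x.2 (Subtype.ext e)⟩,
        fun e => x.1.2.1 (congrArg Subtype.val (Sum.inl.inj e)),
        fun e => x.1.2.2 (congrArg Subtype.val (Sum.inl.inj e))⟩
    | .inr y => ⟨.inr y, Sum.inr_ne_inl, Sum.inr_ne_inl⟩
  invFun
    | ⟨.inl x, hx⟩ => .inl ⟨⟨x.1, fun e => hx.1 (congrArg Sum.inl (Subtype.ext e)),
        fun e => hx.2 (congrArg Sum.inl (Subtype.ext e))⟩,
        fun e => x.2 (congrArg Subtype.val e)⟩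
    | ⟨.inr y, _⟩ => .inr y
  left_inv := by rintro (x | y) <;> rfl
  right_inv := by rintro ⟨x | y, h⟩ <;> rfl

end Relabel

/-- A cyclic operad in sets: a functor from finite sets and bijections to sets, with operations
`∘_{ab} : C(S) × C(T) → C((S ∖ a) ⊔ (T ∖ b))` for `a ∈ S`, `b ∈ T`, which are equivariant,
commutative and associative. -/
structure CyclicOperad where
  obj : (S : Type) → [Finite S] → Type u
  map : {S T : Type} → [Finite S] → [Finite T] → (S ≃ T) → obj S → obj T
  comp : {S T : Type} → [Finite S] → [Finite T] → (a : S) → (b : T) →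
    obj S → obj T → obj (Rest a ⊕ Rest b)
  map_refl : ∀ {S : Type} [Finite S] (x : obj S), map (Equiv.refl S) x = x
  map_trans : ∀ {S T U : Type} [Finite S] [Finite T] [Finite U] (σ : S ≃ T) (τ : T ≃ U)
    (x : obj S), map (σ.trans τ) x = map τ (map σ x)
  comp_map : ∀ {S T S' T' : Type} [Finite S] [Finite T] [Finite S'] [Finite T']
    (σ : S ≃ S') (τ : T ≃ T') (a : S) (b : T) (x : obj S) (y : obj T),
    comp (σ a) (τ b) (map σ x) (map τ y) =
      map (Equiv.sumCongr (Relabel.rest σ a) (Relabel.rest τ b)) (comp a b x y)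
  comp_comm : ∀ {S T : Type} [Finite S] [Finite T] (a : S) (b : T) (x : obj S) (y : obj T),
    comp b a y x = map (Equiv.sumComm (Rest a) (Rest b)) (comp a b x y)
  comp_assoc : ∀ {S T U : Type} [Finite S] [Finite T] [Finite U]
    (a : S) (b c : T) (d : U) (h : b ≠ c) (x : obj S) (y : obj T) (z : obj U),
    comp a (Sum.inl ⟨b, h⟩) x (comp c d y z) =
      map (Relabel.assoc a b c d h) (comp (Sum.inr ⟨c, h.symm⟩) d (comp a b x y) z)

/-- A morphism of cyclic operads. -/
@[ext] structure CyclicOperad.Hom (C : CyclicOperad.{u}) (D : CyclicOperad.{v}) where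
  app : (S : Type) → [Finite S] → C.obj S → D.obj S
  app_map : ∀ {S T : Type} [Finite S] [Finite T] (σ : S ≃ T) (x : C.obj S),
    app T (C.map σ x) = D.map σ (app S x)
  app_comp : ∀ {S T : Type} [Finite S] [Finite T] (a : S) (b : T) (x : C.obj S) (y : C.obj T),
    app _ (C.comp a b x y) = D.comp a b (app S x) (app T y)

/-- The composite of two morphisms of cyclic operads (first `F`, then `G`). -/
def CyclicOperad.Hom.trans {C : CyclicOperad.{u}} {D : CyclicOperad.{v}} {E : CyclicOperad.{w}}
    (F : C.Hom D) (G : D.Hom E) : C.Hom E where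
  app S _ x := G.app S (F.app S x)
  app_map σ x := by rw [F.app_map, G.app_map]
  app_comp a b x y := by rw [F.app_comp, G.app_comp]

/-- A cyclic suboperad: subsets `B(S) ⊆ C(S)` closed under relabelling and `∘_{ab}`. -/
structure CyclicSuboperad (C : CyclicOperad.{u}) where
  carrier : (S : Type) → [Finite S] → Set (C.obj S)
  map_mem : ∀ {S T : Type} [Finite S] [Finite T] (σ : S ≃ T) {x : C.obj S},
    x ∈ carrier S → C.map σ x ∈ carrier T
  comp_mem : ∀ {S T : Type} [Finite S] [Finite T] (a : S) (b : T) {x : C.obj S} {y : C.obj T},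
    x ∈ carrier S → y ∈ carrier T → C.comp a b x y ∈ carrier (Rest a ⊕ Rest b)

namespace CyclicSuboperad

variable {C : CyclicOperad.{u}} (B : CyclicSuboperad C)

/-- A cyclic suboperad as a cyclic operad in its own right. -/
def toCyclicOperad : CyclicOperad.{u} where
  obj S _ := {x : C.obj S // x ∈ B.carrier S}
  map σ x := ⟨C.map σ x.1, B.map_mem σ x.2⟩
  comp a b x y := ⟨C.comp a b x.1 y.1, B.comp_mem a b x.2 y.2⟩
  map_refl x := Subtype.ext (C.map_refl x.1)
  map_trans σ τ x := Subtype.ext (C.map_trans σ τ x.1)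
  comp_map σ τ a b x y := Subtype.ext (C.comp_map σ τ a b x.1 y.1)
  comp_comm a b x y := Subtype.ext (C.comp_comm a b x.1 y.1)
  comp_assoc a b c d h x y z := Subtype.ext (C.comp_assoc a b c d h x.1 y.1 z.1)

/-- The inclusion of a cyclic suboperad. -/
def incl : B.toCyclicOperad.Hom C where
  app _ _ x := x.1
  app_map _ _ := rfl
  app_comp _ _ _ _ := rfl

end CyclicSuboperad

/-- A modular operad in sets, with operadic genus in a commutative monoid `𝕊` with a
distinguished element `1`. The set `obj S` is the disjoint union of the components `M(S; G)`,
`G ∈ 𝕊`, and `genus` sends the elements of `M(S; G)` to `G`. -/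
structure ModularOperad (𝕊 : Type v) [AddCommMonoidWithOne 𝕊] extends CyclicOperad.{u} where
  genus : {S : Type} → [Finite S] → obj S → 𝕊
  contr : {S : Type} → [Finite S] → (a b : S) → a ≠ b → obj S → obj (Rest₂ a b)
  genus_map : ∀ {S T : Type} [Finite S] [Finite T] (σ : S ≃ T) (x : obj S),
    genus (map σ x) = genus x
  genus_comp : ∀ {S T : Type} [Finite S] [Finite T] (a : S) (b : T) (x : obj S) (y : obj T),
    genus (comp a b x y) = genus x + genus y
  genus_contr : ∀ {S : Type} [Finite S] (a b : S) (h : a ≠ b) (x : obj S),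
    genus (contr a b h x) = genus x + 1
  contr_map : ∀ {S T : Type} [Finite S] [Finite T] (σ : S ≃ T) (a b : S) (h : a ≠ b)
    (x : obj S), contr (σ a) (σ b) (σ.injective.ne h) (map σ x) =
      map (Relabel.rest₂ σ a b) (contr a b h x)
  contr_comm : ∀ {S : Type} [Finite S] (a b : S) (h : a ≠ b) (x : obj S),
    contr b a h.symm x = map (Relabel.rest₂Comm a b) (contr a b h x)
  contr_contr : ∀ {S : Type} [Finite S] (a b c d : S) (hab : a ≠ b) (hcd : c ≠ d)
    (hca : c ≠ a) (hcb : c ≠ b) (hda : d ≠ a) (hdb : d ≠ b) (x : obj S),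
    contr ⟨a, hca.symm, hda.symm⟩ ⟨b, hcb.symm, hdb.symm⟩
        (fun e => hab (congrArg Subtype.val e)) (contr c d hcd x) =
      map (Relabel.contrContr a b c d hca hcb hda hdb)
        (contr ⟨c, hca, hcb⟩ ⟨d, hda, hdb⟩ (fun e => hcd (congrArg Subtype.val e))
          (contr a b hab x))
  contr_interchange : ∀ {S T : Type} [Finite S] [Finite T] (a c : S) (b d : T)
    (hac : a ≠ c) (hbd : b ≠ d) (x : obj S) (y : obj T),
    contr (Sum.inl ⟨c, hac.symm⟩) (Sum.inr ⟨d, hbd.symm⟩) Sum.inl_ne_inr (comp a b x y) =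
      map (Relabel.interchange a c b d hac hbd)
        (contr (Sum.inl ⟨a, hac⟩) (Sum.inr ⟨b, hbd⟩) Sum.inl_ne_inr (comp c d x y))
  contr_comp : ∀ {S T : Type} [Finite S] [Finite T] (a c d : S) (b : T)
    (hac : a ≠ c) (had : a ≠ d) (hcd : c ≠ d) (x : obj S) (y : obj T),
    contr (Sum.inl ⟨c, hac.symm⟩) (Sum.inl ⟨d, had.symm⟩)
        (fun e => hcd (congrArg Subtype.val (Sum.inl.inj e))) (comp a b x y) =
      map (Relabel.contrComp a c d b hac had) (comp ⟨a, hac, had⟩ b (contr c d hcd x) y)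

namespace ModularOperad

variable {𝕊 : Type v} [AddCommMonoidWithOne 𝕊]

/-- A morphism of modular operads. -/
@[ext] structure Hom (M : ModularOperad.{u} 𝕊) (N : ModularOperad.{w} 𝕊) extends
    CyclicOperad.Hom M.toCyclicOperad N.toCyclicOperad where
  genus_app : ∀ {S : Type} [Finite S] (x : M.obj S), N.genus (app S x) = M.genus x
  app_contr : ∀ {S : Type} [Finite S] (a b : S) (h : a ≠ b) (x : M.obj S),
    app _ (M.contr a b h x) = N.contr a b h (app S x)

/-- The forgetful functor `□` from modular operads to cyclic operads on objects: it keeps the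
genus zero part. -/
def square (M : ModularOperad.{u} 𝕊) : CyclicOperad.{u} where
  obj S _ := {x : M.obj S // M.genus x = 0}
  map σ x := ⟨M.map σ x.1, (M.genus_map σ x.1).trans x.2⟩
  comp a b x y := ⟨M.comp a b x.1 y.1, by rw [M.genus_comp, x.2, y.2, add_zero]⟩
  map_refl x := Subtype.ext (M.map_refl x.1)
  map_trans σ τ x := Subtype.ext (M.map_trans σ τ x.1)
  comp_map σ τ a b x y := Subtype.ext (M.comp_map σ τ a b x.1 y.1)
  comp_comm a b x y := Subtype.ext (M.comp_comm a b x.1 y.1)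
  comp_assoc a b c d h x y z := Subtype.ext (M.comp_assoc a b c d h x.1 y.1 z.1)

/-- The forgetful functor `□` on morphisms. -/
def Hom.square {M : ModularOperad.{u} 𝕊} {N : ModularOperad.{w} 𝕊} (F : M.Hom N) :
    M.square.Hom N.square where
  app S _ x := ⟨F.app S x.1, (F.genus_app x.1).trans x.2⟩
  app_map σ x := Subtype.ext (F.app_map σ x.1)
  app_comp a b x y := Subtype.ext (F.app_comp a b x.1 y.1)

end ModularOperad

/-! ### The modular completion

It is built by generators and relations: formal expressions in elements of `C`, modulo the axioms
of modular operads and the identification of the formal operations between elements of `C` with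
those of `C`. -/

/-- Formal expressions in elements of `C` with free labels in `S`. -/
inductive ModWord (C : CyclicOperad.{u}) : (S : Type) → [Finite S] → Type (max 1 u)
  | gen {S : Type} [Finite S] (x : C.obj S) : ModWord C S
  | map {S T : Type} [Finite S] [Finite T] (σ : S ≃ T) (x : ModWord C S) : ModWord C T
  | comp {S T : Type} [Finite S] [Finite T] (a : S) (b : T) (x : ModWord C S)
      (y : ModWord C T) : ModWord C (Rest a ⊕ Rest b)
  | contr {S : Type} [Finite S] (a b : S) (h : a ≠ b) (x : ModWord C S) : ModWord C (Rest₂ a b)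

namespace ModWord

variable {C : CyclicOperad.{u}}

/-- The genus of a formal expression: the number of contractions. -/
def genus (𝕊 : Type v) [AddCommMonoidWithOne 𝕊] : {S : Type} → [Finite S] → ModWord C S → 𝕊
  | _, _, gen _ => 0
  | _, _, map _ x => genus 𝕊 x
  | _, _, comp _ _ x y => genus 𝕊 x + genus 𝕊 y
  | _, _, contr _ _ _ x => genus 𝕊 x + 1

/-- The congruence defining the modular completion. -/
inductive Rel : {S : Type} → [Finite S] → ModWord C S → ModWord C S → Prop
  | refl {S : Type} [Finite S] (x : ModWord C S) : Rel x x
  | symm {S : Type} [Finite S] {x y : ModWord C S} : Rel x y → Rel y x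
  | trans {S : Type} [Finite S] {x y z : ModWord C S} : Rel x y → Rel y z → Rel x z
  | congr_map {S T : Type} [Finite S] [Finite T] (σ : S ≃ T) {x y : ModWord C S} :
      Rel x y → Rel (map σ x) (map σ y)
  | congr_comp {S T : Type} [Finite S] [Finite T] (a : S) (b : T) {x x' : ModWord C S}
      {y y' : ModWord C T} : Rel x x' → Rel y y' → Rel (comp a b x y) (comp a b x' y')
  | congr_contr {S : Type} [Finite S] (a b : S) (h : a ≠ b) {x y : ModWord C S} :
      Rel x y → Rel (contr a b h x) (contr a b h y)
  | gen_map {S T : Type} [Finite S] [Finite T] (σ : S ≃ T) (x : C.obj S) :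
      Rel (gen (C.map σ x)) (map σ (gen x))
  | gen_comp {S T : Type} [Finite S] [Finite T] (a : S) (b : T) (x : C.obj S) (y : C.obj T) :
      Rel (gen (C.comp a b x y)) (comp a b (gen x) (gen y))
  | map_refl {S : Type} [Finite S] (x : ModWord C S) : Rel (map (Equiv.refl S) x) x
  | map_trans {S T U : Type} [Finite S] [Finite T] [Finite U] (σ : S ≃ T) (τ : T ≃ U)
      (x : ModWord C S) : Rel (map (σ.trans τ) x) (map τ (map σ x))
  | comp_map {S T S' T' : Type} [Finite S] [Finite T] [Finite S'] [Finite T']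
      (σ : S ≃ S') (τ : T ≃ T') (a : S) (b : T) (x : ModWord C S) (y : ModWord C T) :
      Rel (comp (σ a) (τ b) (map σ x) (map τ y))
        (map (Equiv.sumCongr (Relabel.rest σ a) (Relabel.rest τ b)) (comp a b x y))
  | comp_comm {S T : Type} [Finite S] [Finite T] (a : S) (b : T) (x : ModWord C S)
      (y : ModWord C T) :
      Rel (comp b a y x) (map (Equiv.sumComm (Rest a) (Rest b)) (comp a b x y))
  | comp_assoc {S T U : Type} [Finite S] [Finite T] [Finite U] (a : S) (b c : T) (d : U)
      (h : b ≠ c) (x : ModWord C S) (y : ModWord C T) (z : ModWord C U) :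
      Rel (comp a (Sum.inl ⟨b, h⟩) x (comp c d y z))
        (map (Relabel.assoc a b c d h) (comp (Sum.inr ⟨c, h.symm⟩) d (comp a b x y) z))
  | contr_map {S T : Type} [Finite S] [Finite T] (σ : S ≃ T) (a b : S) (h : a ≠ b)
      (x : ModWord C S) : Rel (contr (σ a) (σ b) (σ.injective.ne h) (map σ x))
        (map (Relabel.rest₂ σ a b) (contr a b h x))
  | contr_comm {S : Type} [Finite S] (a b : S) (h : a ≠ b) (x : ModWord C S) :
      Rel (contr b a h.symm x) (map (Relabel.rest₂Comm a b) (contr a b h x))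
  | contr_contr {S : Type} [Finite S] (a b c d : S) (hab : a ≠ b) (hcd : c ≠ d)
      (hca : c ≠ a) (hcb : c ≠ b) (hda : d ≠ a) (hdb : d ≠ b) (x : ModWord C S) :
      Rel (contr ⟨a, hca.symm, hda.symm⟩ ⟨b, hcb.symm, hdb.symm⟩
          (fun e => hab (congrArg Subtype.val e)) (contr c d hcd x))
        (map (Relabel.contrContr a b c d hca hcb hda hdb)
          (contr ⟨c, hca, hcb⟩ ⟨d, hda, hdb⟩ (fun e => hcd (congrArg Subtype.val e))
            (contr a b hab x)))
  | contr_interchange {S T : Type} [Finite S] [Finite T] (a c : S) (b d : T)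
      (hac : a ≠ c) (hbd : b ≠ d) (x : ModWord C S) (y : ModWord C T) :
      Rel (contr (Sum.inl ⟨c, hac.symm⟩) (Sum.inr ⟨d, hbd.symm⟩) Sum.inl_ne_inr (comp a b x y))
        (map (Relabel.interchange a c b d hac hbd)
          (contr (Sum.inl ⟨a, hac⟩) (Sum.inr ⟨b, hbd⟩) Sum.inl_ne_inr (comp c d x y)))
  | contr_comp {S T : Type} [Finite S] [Finite T] (a c d : S) (b : T)
      (hac : a ≠ c) (had : a ≠ d) (hcd : c ≠ d) (x : ModWord C S) (y : ModWord C T) :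
      Rel (contr (Sum.inl ⟨c, hac.symm⟩) (Sum.inl ⟨d, had.symm⟩)
          (fun e => hcd (congrArg Subtype.val (Sum.inl.inj e))) (comp a b x y))
        (map (Relabel.contrComp a c d b hac had)
          (comp ⟨a, hac, had⟩ b (contr c d hcd x) y))

theorem Rel.genus_eq (𝕊 : Type v) [AddCommMonoidWithOne 𝕊] {S : Type} [Finite S]
    {x y : ModWord C S} (h : Rel x y) : x.genus 𝕊 = y.genus 𝕊 := by
  induction h with
  | refl => rfl
  | symm _ ih => exact ih.symm
  | trans _ _ ih₁ ih₂ => exact ih₁.trans ih₂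
  | congr_map _ _ ih => exact ih
  | congr_comp _ _ _ _ ih₁ ih₂ => simp only [genus, ih₁, ih₂]
  | congr_contr _ _ _ _ ih => simp only [genus, ih]
  | comp_comm => simp only [genus, add_comm]
  | _ => simp only [genus, add_zero, add_assoc, add_comm, add_left_comm]

/-- Formal expressions up to the congruence. -/
instance setoid (C : CyclicOperad.{u}) (S : Type) [Finite S] : Setoid (ModWord C S) where
  r := Rel
  iseqv := ⟨Rel.refl, Rel.symm, Rel.trans⟩

/-- Evaluation of formal expressions in a modular operad `N`, given the values of the elements
of `C`. -/
def eval {𝕊 : Type v} [AddCommMonoidWithOne 𝕊] {N : ModularOperad.{w} 𝕊}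
    (F : C.Hom N.square) : {S : Type} → [Finite S] → ModWord C S → N.obj S
  | _, _, gen x => (F.app _ x).1
  | _, _, map σ x => N.map σ (eval F x)
  | _, _, comp a b x y => N.comp a b (eval F x) (eval F y)
  | _, _, contr a b h x => N.contr a b h (eval F x)

theorem Rel.eval_eq {𝕊 : Type v} [AddCommMonoidWithOne 𝕊] {N : ModularOperad.{w} 𝕊}
    (F : C.Hom N.square) {S : Type} [Finite S] {x y : ModWord C S} (h : Rel x y) :
    x.eval F = y.eval F := by
  induction h with
  | refl => rfl
  | symm _ ih => exact ih.symm
  | trans _ _ ih₁ ih₂ => exact ih₁.trans ih₂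
  | congr_map _ _ ih => simp only [eval, ih]
  | congr_comp _ _ _ _ ih₁ ih₂ => simp only [eval, ih₁, ih₂]
  | congr_contr _ _ _ _ ih => simp only [eval, ih]
  | gen_map σ x => exact congrArg Subtype.val (F.app_map σ x)
  | gen_comp a b x y => exact congrArg Subtype.val (F.app_comp a b x y)
  | map_refl => exact N.map_refl _
  | map_trans => exact N.map_trans _ _ _
  | comp_map => exact N.comp_map _ _ _ _ _ _
  | comp_comm => exact N.comp_comm _ _ _ _
  | comp_assoc => exact N.comp_assoc _ _ _ _ _ _ _ _
  | contr_map => exact N.contr_map _ _ _ _ _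
  | contr_comm => exact N.contr_comm _ _ _ _
  | contr_contr => exact N.contr_contr _ _ _ _ _ _ _ _ _ _ _
  | contr_interchange => exact N.contr_interchange _ _ _ _ _ _ _ _
  | contr_comp => exact N.contr_comp _ _ _ _ _ _ _ _ _

theorem genus_eval {𝕊 : Type v} [AddCommMonoidWithOne 𝕊] {N : ModularOperad.{w} 𝕊}
    (F : C.Hom N.square) {S : Type} [Finite S] (x : ModWord C S) :
    N.genus (x.eval F) = x.genus 𝕊 := by
  induction x with
  | gen x => exact (F.app _ x).2
  | map σ x ih => exact (N.genus_map _ _).trans ih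
  | comp a b x y ih₁ ih₂ => simp only [eval, genus, N.genus_comp, ih₁, ih₂]
  | contr a b h x ih => simp only [eval, genus, N.genus_contr, ih]

end ModWord

namespace CyclicOperad

variable (𝕊 : Type v) [AddCommMonoidWithOne 𝕊]

/-- The modular completion `Mod(C)` of a cyclic operad `C`. -/
def modCompletion (C : CyclicOperad.{u}) : ModularOperad.{max 1 u} 𝕊 where
  obj S _ := Quotient (ModWord.setoid C S)
  map σ := Quotient.map (ModWord.map σ) (fun _ _ h => .congr_map σ h)
  comp a b := Quotient.map₂ (ModWord.comp a b) (fun _ _ h _ _ h' => .congr_comp a b h h')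
  genus := Quotient.lift (ModWord.genus 𝕊) (fun _ _ h => h.genus_eq 𝕊)
  contr a b h := Quotient.map (ModWord.contr a b h) (fun _ _ h' => .congr_contr a b h h')
  map_refl := by rintro S _ ⟨x⟩; exact Quotient.sound (.map_refl x)
  map_trans := by rintro S T U _ _ _ σ τ ⟨x⟩; exact Quotient.sound (.map_trans σ τ x)
  comp_map := by
    rintro S T S' T' _ _ _ _ σ τ a b ⟨x⟩ ⟨y⟩; exact Quotient.sound (.comp_map σ τ a b x y)
  comp_comm := by rintro S T _ _ a b ⟨x⟩ ⟨y⟩; exact Quotient.sound (.comp_comm a b x y)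
  comp_assoc := by
    rintro S T U _ _ _ a b c d h ⟨x⟩ ⟨y⟩ ⟨z⟩
    exact Quotient.sound (.comp_assoc a b c d h x y z)
  genus_map := by rintro S T _ _ σ ⟨x⟩; rfl
  genus_comp := by rintro S T _ _ a b ⟨x⟩ ⟨y⟩; rfl
  genus_contr := by rintro S _ a b h ⟨x⟩; rfl
  contr_map := by rintro S T _ _ σ a b h ⟨x⟩; exact Quotient.sound (.contr_map σ a b h x)
  contr_comm := by rintro S _ a b h ⟨x⟩; exact Quotient.sound (.contr_comm a b h x)
  contr_contr := by
    rintro S _ a b c d hab hcd hca hcb hda hdb ⟨x⟩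
    exact Quotient.sound (.contr_contr a b c d hab hcd hca hcb hda hdb x)
  contr_interchange := by
    rintro S T _ _ a c b d hac hbd ⟨x⟩ ⟨y⟩
    exact Quotient.sound (.contr_interchange a c b d hac hbd x y)
  contr_comp := by
    rintro S T _ _ a c d b hac had hcd ⟨x⟩ ⟨y⟩
    exact Quotient.sound (.contr_comp a c d b hac had hcd x y)

/-- The unit `C → □ Mod(C)`. -/
def modUnit (C : CyclicOperad.{u}) : C.Hom (C.modCompletion 𝕊).square where
  app _ _ x := ⟨Quotient.mk _ (ModWord.gen x), rfl⟩
  app_map σ x := Subtype.ext (Quotient.sound (.gen_map σ x))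
  app_comp a b x y := Subtype.ext (Quotient.sound (.gen_comp a b x y))

variable {𝕊}

/-- The extension of a morphism `C → □ N` to a morphism `Mod(C) → N`. -/
def modLift {C : CyclicOperad.{u}} {N : ModularOperad.{w} 𝕊} (F : C.Hom N.square) :
    (C.modCompletion 𝕊).Hom N where
  app _ _ := Quotient.lift (ModWord.eval F) (fun _ _ h => h.eval_eq F)
  app_map := by rintro S T _ _ σ ⟨x⟩; rfl
  app_comp := by rintro S T _ _ a b ⟨x⟩ ⟨y⟩; rfl
  genus_app := by rintro S _ ⟨x⟩; exact ModWord.genus_eval F x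
  app_contr := by rintro S _ a b h ⟨x⟩; rfl

/-- The universal property of the modular completion: `Mod` is left adjoint to `□`. -/
theorem existsUnique_modLift {C : CyclicOperad.{u}} {N : ModularOperad.{w} 𝕊}
    (F : C.Hom N.square) :
    ∃! G : (C.modCompletion 𝕊).Hom N, (C.modUnit 𝕊).trans G.square = F := by
  refine ⟨modLift F, rfl, fun G hG => ?_⟩
  subst hG
  have key : ∀ {S : Type} [Finite S] (x : ModWord C S), G.app S (Quotient.mk _ x) =
      x.eval ((C.modUnit 𝕊).trans G.square) := by
    intro S _ x
    induction x with
    | gen x => rfl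
    | map σ x ih => exact (G.app_map σ (Quotient.mk _ x)).trans (congrArg (N.map σ) ih)
    | comp a b x y ih₁ ih₂ =>
        exact (G.app_comp a b (Quotient.mk _ x) (Quotient.mk _ y)).trans
          (congrArg₂ (N.comp a b) ih₁ ih₂)
    | contr a b h x ih =>
        exact (G.app_contr a b h (Quotient.mk _ x)).trans (congrArg (N.contr a b h) ih)
  ext S _ x
  obtain ⟨x⟩ := x
  exact key x

/-- The map `Mod(C) → Mod(D)` induced by a morphism `C → D` of cyclic operads. -/
def modMap {C : CyclicOperad.{u}} {D : CyclicOperad.{v}} (𝕊 : Type w) [AddCommMonoidWithOne 𝕊]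
    (F : C.Hom D) : (C.modCompletion 𝕊).Hom (D.modCompletion 𝕊) :=
  modLift (F.trans (D.modUnit 𝕊))

end CyclicOperad

/-! By the interchange laws, every contraction and composition in a formal expression can be
reorganised so that all compositions in `C` come before all contractions. An element of `Mod(C)(S)`
is thus represented by one element of `C(X)` together with a gluing: an injection `S → X` and a
perfect matching of the remaining labels (`GluedElt`). The ambiguity of this normal form is
generated by two moves (`GluedElt.Step`): relabelling, and replacing `w ∘_{qs} w'` by `w ∘_{pr} w'`
when the freed labels form an edge. Only one direction is needed: congruent expressions have glued
elements connected by moves (`ModWord.Rel.glued`).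

Conversely, a glued element with value in `B` can be contracted along all its edges inside `Mod(B)`.
The result exists and does not depend on the order of the edges (`Contracts.exists_contracts`,
`Contracts.unique`), and the glued element of an expression over `B` contracts back to the class of
that expression (`contractsTo_glued`).

The hypothesis on `B` ensures that a move in `C` which starts in `B` ends in `B` and preserves the
contraction (`contractsTo_of_interchange`). In case (i) the move acts as a relabelling that can only
permute the end points of one edge; in case (ii) it is an interchange between elements of `B`, which
the modular operad `Mod(B)` already respects. So if two expressions over `B` become equal in
`Mod(C)`, a chain of moves connects them within `B`, and their contractions in `Mod(B)` coincide. -/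

/-! ### Gluings of finite label sets -/

/-- A way to glue labels in `X` such that the labels in `S` remain: an injection `S → X` and a
perfect matching of its complement. -/
@[ext] structure Gluing (S X : Type) where
  leg : S → X
  edge : X → X → Prop
  leg_injective : Function.Injective leg
  edge_symm : ∀ {u v}, edge u v → edge v u
  edge_irrefl : ∀ u, ¬ edge u u
  edge_unique : ∀ {u v w}, edge u v → edge u w → v = w
  not_edge_leg : ∀ s v, ¬ edge (leg s) v
  leg_or_edge : ∀ u, (∃ s, leg s = u) ∨ ∃ v, edge u v

namespace Gluing

variable {S T X Y : Type}

theorem edge.ne {g : Gluing S X} {u v : X} (h : g.edge u v) : u ≠ v := by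
  rintro rfl; exact g.edge_irrefl _ h

theorem edge.leg_ne {g : Gluing S X} {u v : X} (h : g.edge u v) (s : S) : g.leg s ≠ u := by
  rintro rfl; exact g.not_edge_leg _ _ h

/-- The gluing without edges. -/
def refl (S : Type) : Gluing S S where
  leg := id
  edge _ _ := False
  leg_injective := Function.injective_id
  edge_symm := id
  edge_irrefl _ := id
  edge_unique h := h.elim
  not_edge_leg _ _ := id
  leg_or_edge u := .inl ⟨u, rfl⟩

/-- Rename the remaining labels. -/
def map (σ : S ≃ T) (g : Gluing S X) : Gluing T X where
  leg t := g.leg (σ.symm t)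
  edge := g.edge
  leg_injective := g.leg_injective.comp σ.symm.injective
  edge_symm := g.edge_symm
  edge_irrefl := g.edge_irrefl
  edge_unique := g.edge_unique
  not_edge_leg t := g.not_edge_leg _
  leg_or_edge u := (g.leg_or_edge u).imp (fun ⟨s, h⟩ => ⟨σ s, by simpa using h⟩) id

/-- Add an edge between two remaining labels. -/
def contr (a b : S) (h : a ≠ b) (g : Gluing S X) : Gluing (Rest₂ a b) X where
  leg s := g.leg s.1
  edge u v := g.edge u v ∨ (u = g.leg a ∧ v = g.leg b) ∨ (u = g.leg b ∧ v = g.leg a)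
  leg_injective s t e := Subtype.ext (g.leg_injective e)
  edge_symm := by
    rintro u v (h | h | h)
    · exact .inl (g.edge_symm h)
    · exact .inr (.inr h.symm)
    · exact .inr (.inl h.symm)
  edge_irrefl := by
    rintro u (e | ⟨rfl, e⟩ | ⟨rfl, e⟩)
    · exact g.edge_irrefl _ e
    · exact h (g.leg_injective e)
    · exact h (g.leg_injective e.symm)
  edge_unique := by
    rintro u v w (e | ⟨rfl, rfl⟩ | ⟨rfl, rfl⟩) (e' | ⟨e', rfl⟩ | ⟨e', rfl⟩)
    · exact g.edge_unique e e'
    · exact absurd e'.symm (e.leg_ne _)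
    · exact absurd e'.symm (e.leg_ne _)
    · exact absurd e' (g.not_edge_leg _ _)
    · rfl
    · exact absurd (g.leg_injective e') h
    · exact absurd e' (g.not_edge_leg _ _)
    · exact absurd (g.leg_injective e').symm h
    · rfl
  not_edge_leg := by
    rintro s v (e | ⟨e, -⟩ | ⟨e, -⟩)
    · exact g.not_edge_leg _ _ e
    · exact s.2.1 (g.leg_injective e)
    · exact s.2.2 (g.leg_injective e)
  leg_or_edge u := by
    rcases g.leg_or_edge u with ⟨s, rfl⟩ | ⟨v, e⟩
    · by_cases ha : s = a
      · exact .inr ⟨g.leg b, .inr (.inl ⟨by rw [ha], rfl⟩)⟩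
      by_cases hb : s = b
      · exact .inr ⟨g.leg a, .inr (.inr ⟨by rw [hb], rfl⟩)⟩
      exact .inl ⟨⟨s, ha, hb⟩, rfl⟩
    · exact .inr ⟨v, .inl e⟩

/-- Restrict a gluing to the complement of a remaining label. -/
def rest (a : S) (g : Gluing S X) : Gluing (Rest a) (Rest (g.leg a)) where
  leg s := ⟨g.leg s.1, g.leg_injective.ne s.2⟩
  edge u v := g.edge u.1 v.1
  leg_injective s t e := Subtype.ext (g.leg_injective (congrArg Subtype.val e))
  edge_symm := g.edge_symm
  edge_irrefl u := g.edge_irrefl u.1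
  edge_unique e e' := Subtype.ext (g.edge_unique e e')
  not_edge_leg s v := g.not_edge_leg s.1 v.1
  leg_or_edge u := by
    rcases g.leg_or_edge u.1 with ⟨s, e⟩ | ⟨v, e⟩
    · exact .inl ⟨⟨s, fun h => u.2 (by rw [← e, h])⟩, Subtype.ext e⟩
    · exact .inr ⟨⟨v, ((g.edge_symm e).leg_ne a).symm⟩, e⟩

/-- The disjoint union of two gluings. -/
def sum (g : Gluing S X) (g' : Gluing T Y) : Gluing (S ⊕ T) (X ⊕ Y) where
  leg := Sum.map g.leg g'.leg
  edge
    | .inl u, .inl v => g.edge u v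
    | .inr u, .inr v => g'.edge u v
    | _, _ => False
  leg_injective := g.leg_injective.sumMap g'.leg_injective
  edge_symm := by
    rintro (u | u) (v | v) e
    exacts [g.edge_symm e, e, e, g'.edge_symm e]
  edge_irrefl := by
    rintro (u | u) e
    exacts [g.edge_irrefl _ e, g'.edge_irrefl _ e]
  edge_unique := by
    rintro (u | u) (v | v) (w | w) e e'
    exacts [congrArg _ (g.edge_unique e e'), e'.elim, e.elim, e.elim, e.elim, e.elim, e'.elim,
      congrArg _ (g'.edge_unique e e')]
  not_edge_leg := by
    rintro (s | s) (v | v) e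
    exacts [g.not_edge_leg _ _ e, e, e, g'.not_edge_leg _ _ e]
  leg_or_edge := by
    rintro (u | u)
    · rcases g.leg_or_edge u with ⟨s, rfl⟩ | ⟨v, e⟩
      · exact .inl ⟨.inl s, rfl⟩
      · exact .inr ⟨.inl v, e⟩
    · rcases g'.leg_or_edge u with ⟨s, rfl⟩ | ⟨v, e⟩
      · exact .inl ⟨.inr s, rfl⟩
      · exact .inr ⟨.inr v, e⟩

/-- The gluing of a composite. -/
def comp (a : S) (b : T) (g : Gluing S X) (g' : Gluing T Y) :
    Gluing (Rest a ⊕ Rest b) (Rest (g.leg a) ⊕ Rest (g'.leg b)) :=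
  (g.rest a).sum (g'.rest b)

/-- Remove an edge together with its end points. -/
def remove (u v : X) (g : Gluing S X) (h : g.edge u v) : Gluing S (Rest₂ u v) where
  leg s := ⟨g.leg s, h.leg_ne s, (g.edge_symm h).leg_ne s⟩
  edge x y := g.edge x.1 y.1
  leg_injective s t e := g.leg_injective (congrArg Subtype.val e)
  edge_symm := g.edge_symm
  edge_irrefl u := g.edge_irrefl u.1
  edge_unique e e' := Subtype.ext (g.edge_unique e e')
  not_edge_leg s v := g.not_edge_leg s v.1
  leg_or_edge x := by
    rcases g.leg_or_edge x.1 with ⟨s, e⟩ | ⟨y, e⟩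
    · exact .inl ⟨s, Subtype.ext e⟩
    · refine .inr ⟨⟨y, ?_, ?_⟩, e⟩
      · rintro rfl; exact x.2.2 (g.edge_unique (g.edge_symm e) h)
      · rintro rfl; exact x.2.1 (g.edge_unique (g.edge_symm e) (g.edge_symm h))

/-- A bijection is compatible with two gluings. -/
structure IsIso (σ : X ≃ Y) (g : Gluing S X) (g' : Gluing S Y) : Prop where
  leg : ∀ s, g'.leg s = σ (g.leg s)
  edge : ∀ u v, g'.edge (σ u) (σ v) ↔ g.edge u v

theorem IsIso.remove {σ : X ≃ Y} {g : Gluing S X} {g' : Gluing S Y} (i : IsIso σ g g') {u v : X}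
    (h : g.edge u v) :
    IsIso (Relabel.rest₂ σ u v) (g.remove u v h) (g'.remove (σ u) (σ v) ((i.edge u v).2 h)) :=
  ⟨fun s => Subtype.ext (i.leg s), fun x y => i.edge x.1 y.1⟩

end Gluing

/-! ### Contracting an element of a modular operad along a gluing -/

namespace ModularOperad

variable {𝕊 : Type v} [AddCommMonoidWithOne 𝕊] (M : ModularOperad.{u} 𝕊)
variable {S T X Y : Type} [Finite S] [Finite T] [Finite X] [Finite Y]

/-- The element `m` is obtained from `x` by contracting all edges of the gluing `g`. -/
inductive Contracts {S : Type} [Finite S] :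
    {X : Type} → [Finite X] → M.obj X → Gluing S X → M.obj S → Prop
  | base {X : Type} [Finite X] (g : Gluing S X) (e : S ≃ X) (he : ∀ s, g.leg s = e s)
      (m : M.obj S) (x : M.obj X) (hx : M.map e m = x) : Contracts x g m
  | step {X : Type} [Finite X] (g : Gluing S X) (x : M.obj X) (m : M.obj S) (u v : X)
      (h : g.edge u v) : Contracts (M.contr u v h.ne x) (g.remove u v h) m → Contracts x g m

variable {M}

theorem map_symm_map (σ : S ≃ T) (x : M.obj S) : M.map σ.symm (M.map σ x) = x := by
  rw [← M.map_trans, Equiv.self_trans_symm, M.map_refl]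

namespace Contracts

/-- Equivariance of contractions carries a whole contraction sequence along `σ`, edge by edge. -/
theorem iso {x : M.obj X} {g : Gluing S X} {m : M.obj S} (h : M.Contracts x g m) :
    ∀ {Y : Type} [Finite Y] (σ : X ≃ Y) {g' : Gluing S Y}, Gluing.IsIso σ g g' →
      M.Contracts (M.map σ x) g' m := by
  induction h with
  | base g e he m x hx =>
    intro Y _ σ g' i
    refine .base _ (e.trans σ) (fun s => by rw [i.leg, he]; rfl) _ _ ?_
    rw [M.map_trans, hx]
  | step g x m u v h _ ih =>
    intro Y _ σ g' i
    refine .step _ _ _ (σ u) (σ v) ((i.edge _ _).2 h) ?_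
    rw [M.contr_map σ u v h.ne]
    exact ih _ (i.remove h)

theorem card_rest₂_lt {X : Type} [Finite X] (u v : X) : Nat.card (Rest₂ u v) < Nat.card X :=
  Finite.card_subtype_lt (x := u) (fun h => h.1 rfl)

theorem exists_contracts {X : Type} [Finite X] (x : M.obj X) (g : Gluing S X) :
    ∃ m, M.Contracts x g m := by
  induction hn : Nat.card X using Nat.strong_induction_on generalizing X with
  | _ n ih =>
    subst hn
    by_cases he : ∃ u v, g.edge u v
    · obtain ⟨u, v, h⟩ := he
      obtain ⟨m, hm⟩ := ih _ (card_rest₂_lt u v) (M.contr u v h.ne x) (g.remove u v h) rfl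
      exact ⟨m, .step _ _ _ u v h hm⟩
    · have hs : Function.Surjective g.leg := fun u =>
        (g.leg_or_edge u).resolve_right fun ⟨v, h⟩ => he ⟨u, v, h⟩
      let e := Equiv.ofBijective g.leg ⟨g.leg_injective, hs⟩
      exact ⟨M.map e.symm x, .base _ e (fun _ => rfl) _ _ (map_symm_map e.symm x)⟩

/-- A diamond argument by induction on the number of labels: two sequences that start with different
edges are both compared with one that contracts these two edges first. -/
theorem unique {X : Type} [Finite X] {x : M.obj X} {g : Gluing S X} {m m' : M.obj S}
    (h : M.Contracts x g m) (h' : M.Contracts x g m') : m = m' := by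
  induction hn : Nat.card X using Nat.strong_induction_on generalizing X m m' with
  | _ n ih =>
    subst hn
    have no_edge : ∀ (e : S ≃ X) (_ : ∀ s, g.leg s = e s) (u v : X), ¬ g.edge u v :=
      fun e he u v h => h.leg_ne (e.symm u) (by simp [he])
    cases h with
    | base _ e he _ _ hx =>
      cases h' with
      | base _ e' he' _ _ hx' =>
        obtain rfl : e = e' := Equiv.ext fun s => (he s).symm.trans (he' s)
        rw [← map_symm_map e m, hx, ← hx', map_symm_map]
      | step _ _ _ u v h _ => exact absurd h (no_edge e he u v)
    | step _ _ _ u v h k =>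
      cases h' with
      | base _ e' he' _ _ hx' => exact absurd h (no_edge e' he' u v)
      | step _ _ _ u' v' h' k' =>
        by_cases huu : u' = u
        · subst huu
          obtain rfl := g.edge_unique h h'
          exact ih _ (card_rest₂_lt _ _) k k' rfl
        -- The same edge traversed in the opposite direction: `contr_comm` applies.
        by_cases huv : u' = v
        · subst huv
          obtain rfl := g.edge_unique (g.edge_symm h) h'
          refine ih _ (card_rest₂_lt _ _) k ?_ rfl
          rw [M.contr_comm u' u h'.ne]
          exact k'.iso _ ⟨fun _ => rfl, fun _ _ => .rfl⟩
        have hvu : v' ≠ u := by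
          rintro rfl; exact huv (g.edge_unique (g.edge_symm h') h)
        have hvv : v' ≠ v := by
          rintro rfl; exact huu (g.edge_unique (g.edge_symm h') (g.edge_symm h))
        have h₁ : (g.remove u v h).edge ⟨u', huu, huv⟩ ⟨v', hvu, hvv⟩ := h'
        have h₂ : (g.remove u' v' h').edge ⟨u, Ne.symm huu, hvu.symm⟩
          ⟨v, Ne.symm huv, hvv.symm⟩ := h
        -- The edges are now disjoint. A common continuation `m₀` is chosen after both are
        -- contracted, and `contr_contr` identifies the two orders.
        obtain ⟨m₀, k₀⟩ := exists_contracts (M.contr _ _ h₁.ne (M.contr u v h.ne x))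
          ((g.remove u v h).remove _ _ h₁)
        rw [ih _ (card_rest₂_lt _ _) k (.step _ _ _ _ _ h₁ k₀) rfl]
        refine ih _ (card_rest₂_lt _ _) (.step _ _ _ _ _ h₂ ?_) k' rfl
        rw [M.contr_contr u v u' v' h.ne h'.ne huu huv hvu hvv x]
        exact k₀.iso _ ⟨fun _ => rfl, fun _ _ => .rfl⟩

theorem refl (x : M.obj S) : M.Contracts x (Gluing.refl S) x :=
  .base _ (Equiv.refl S) (fun _ => rfl) _ _ (M.map_refl x)

theorem map {x : M.obj X} {g : Gluing S X} {m : M.obj S} (h : M.Contracts x g m) (σ : S ≃ T) :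
    M.Contracts x (g.map σ) (M.map σ m) := by
  induction h with
  | base g e he m x hx =>
    refine .base _ (σ.symm.trans e) (fun s => he _) _ _ ?_
    rw [M.map_trans, map_symm_map, hx]
  | step g x m u v h _ ih => exact .step (g.map σ) _ _ u v h ih

/-- The new edge is contracted last, once the old edges are gone and the legs identify `S` with the
remaining labels. -/
theorem contr {x : M.obj X} {g : Gluing S X} {m : M.obj S} (k : M.Contracts x g m) (a b : S)
    (hab : a ≠ b) : M.Contracts x (g.contr a b hab) (M.contr a b hab m) := by
  induction k with
  | base g e he m x hx =>
    have h : (g.contr a b hab).edge (e a) (e b) := .inr (.inl ⟨(he a).symm, (he b).symm⟩)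
    refine .step _ _ _ _ _ h (.base _ (Relabel.rest₂ e a b) (fun s => Subtype.ext (he s.1)) _ _ ?_)
    rw [← M.contr_map e a b hab, hx]
  | step g x m u v h _ ih =>
    refine .step (g.contr a b hab) _ _ u v (.inl h) ?_
    convert ih using 1
    ext x y
    · rfl
    · simp [Gluing.contr, Gluing.remove, Subtype.ext_iff]

theorem comp_comm {x : M.obj X} {y : M.obj Y} {g : Gluing S X} {g' : Gluing T Y} {a : S} {b : T}
    {m : M.obj (Rest b ⊕ Rest a)}
    (h : M.Contracts (M.comp (g'.leg b) (g.leg a) y x) (g'.comp b a g) m) :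
    M.Contracts (M.comp (g.leg a) (g'.leg b) x y) (g.comp a b g')
      (M.map (Equiv.sumComm _ _) m) := by
  rw [M.comp_comm (g'.leg b)]
  refine (h.map (Equiv.sumComm _ _)).iso (Equiv.sumComm _ _) ⟨?_, ?_⟩
  · rintro (s | s) <;> rfl
  · rintro (u | u) (v | v) <;> exact .rfl

/-- By `contr_comp`, an edge inside one factor may be contracted before or after composing. -/
theorem comp_step_left {x : M.obj X} {y : M.obj Y} {g : Gluing S X} {g' : Gluing T Y} {a : S}
    {b : T} {m : M.obj (Rest a ⊕ Rest b)} {u v : X} (h : g.edge u v)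
    (k : M.Contracts (M.comp ((g.remove u v h).leg a) (g'.leg b) (M.contr u v h.ne x) y)
      ((g.remove u v h).comp a b g') m) :
    M.Contracts (M.comp (g.leg a) (g'.leg b) x y) (g.comp a b g') m := by
  have hu := h.leg_ne a
  have hv := (g.edge_symm h).leg_ne a
  refine .step _ _ _ (.inl ⟨u, hu.symm⟩) (.inl ⟨v, hv.symm⟩) h ?_
  rw [M.contr_comp (g.leg a) u v (g'.leg b) hu hv h.ne]
  refine k.iso _ ⟨?_, ?_⟩
  · rintro (s | s) <;> rfl
  · rintro (u | u) (v | v) <;> exact .rfl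

theorem comp_step_right {x : M.obj X} {y : M.obj Y} {g : Gluing S X} {g' : Gluing T Y} {a : S}
    {b : T} {m : M.obj (Rest a ⊕ Rest b)} {u v : Y} (h : g'.edge u v)
    (k : M.Contracts (M.comp (g.leg a) ((g'.remove u v h).leg b) x (M.contr u v h.ne y))
      (g.comp a b (g'.remove u v h)) m) :
    M.Contracts (M.comp (g.leg a) (g'.leg b) x y) (g.comp a b g') m := by
  have := comp_comm (comp_step_left h (comp_comm k))
  rwa [show ∀ x, M.map (Equiv.sumComm (Rest b) (Rest a)) (M.map (Equiv.sumComm _ _) x) = x from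
    map_symm_map (Equiv.sumComm (Rest a) (Rest b))] at this

theorem comp {x : M.obj X} {y : M.obj Y} {g : Gluing S X} {g' : Gluing T Y}
    {m : M.obj S} {m' : M.obj T} (h : M.Contracts x g m) (h' : M.Contracts y g' m')
    (a : S) (b : T) :
    M.Contracts (M.comp (g.leg a) (g'.leg b) x y) (g.comp a b g') (M.comp a b m m') := by
  induction h with
  | step g x m u v h _ ih => exact comp_step_left h ih
  | base g e he m x hx =>
    induction h' with
    | step g' y m' u v h _ ih => exact comp_step_right h ih
    | base g' e' he' m' y hy =>
      -- The legs equal `e a` and `e' b` only propositionally, and the type of the composite depends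
      -- on them; hence the generalisation over `a'` and `b'`.
      have key : ∀ (a' : _) (b' : _) (ha : a' = e a) (hb : b' = e' b),
          M.comp a' b' x y = M.map (Equiv.sumCongr
            (e.subtypeEquiv fun s => by rw [ha]; simp) (e'.subtypeEquiv fun s => by rw [hb]; simp))
            (M.comp a b m m') := by
        rintro _ _ rfl rfl
        rw [← hx, ← hy, M.comp_map]; rfl
      refine .base _ _ ?_ _ _ (key _ _ (he a) (he' b)).symm
      rintro (s | s)
      · exact congrArg Sum.inl (Subtype.ext (he s.1))
      · exact congrArg Sum.inr (Subtype.ext (he' s.1))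

end Contracts

end ModularOperad

/-! ### Interchange moves in a cyclic operad -/

/-- The restriction of a bijection to the complements of a label and of its image. -/
def Relabel.restTo {S T : Type} (σ : S ≃ T) {a : S} {a' : T} (h : σ a = a') : Rest a ≃ Rest a' :=
  σ.subtypeEquiv fun s => by simp [← h]

namespace CyclicOperad

variable {C : CyclicOperad.{u}} {S T U X Y Z : Type} [Finite U] [Finite X] [Finite Y]
  [Finite Z]

theorem comp_map_of_eq {S' T' : Type} [Finite S] [Finite T] [Finite S'] [Finite T'] (σ : S ≃ S') (τ : T ≃ T') {a : S}
    {b : T} {a' : S'} {b' : T'} (ha : σ a = a') (hb : τ b = b') (x : C.obj S) (y : C.obj T) :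
    C.comp a' b' (C.map σ x) (C.map τ y) =
      C.map (Equiv.sumCongr (Relabel.restTo σ ha) (Relabel.restTo τ hb)) (C.comp a b x y) := by
  subst ha hb
  exact C.comp_map σ τ a b x y

theorem comp_of_eq [Finite S] [Finite T] {a a' : S} {b b' : T} (ha : a = a') (hb : b = b') (x : C.obj S)
    (y : C.obj T) : C.comp a' b' x y = C.map (Equiv.sumCongr (Relabel.restTo (.refl S) ha)
      (Relabel.restTo (.refl T) hb)) (C.comp a b x y) :=
  (congrArg₂ (C.comp a' b') (C.map_refl x).symm (C.map_refl y).symm).trans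
    (comp_map_of_eq (.refl S) (.refl T) ha hb x y)

theorem comp_map_left {S' : Type} [Finite S] [Finite T] [Finite S'] (σ : S ≃ S') {a : S} {a' : S'} (ha : σ a = a')
    (b : T) (x : C.obj S) (y : C.obj T) : C.comp a' b (C.map σ x) y =
      C.map (Equiv.sumCongr (Relabel.restTo σ ha) (.refl _)) (C.comp a b x y) :=
  (congrArg (C.comp a' b (C.map σ x)) (C.map_refl y).symm).trans
    (comp_map_of_eq σ (.refl T) ha rfl x y)

/-- Two elements `w ∘_{qs} w'` and `w ∘_{pr} w'`, relabelled such that the labels `p, r` of the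
former become an edge and the labels `q, s` of the latter take their place. -/
inductive Interchange (edge : X → X → Prop) : C.obj X → C.obj X → Prop
  | mk {Y Z : Type} [Finite Y] [Finite Z] (p q : Y) (r s : Z) (hpq : p ≠ q) (hrs : r ≠ s)
      (w : C.obj Y) (w' : C.obj Z) (ρ : Rest q ⊕ Rest s ≃ X) (ρ' : Rest p ⊕ Rest r ≃ X)
      (hY : ∀ y (hq : y ≠ q) (hp : y ≠ p), ρ (.inl ⟨y, hq⟩) = ρ' (.inl ⟨y, hp⟩))
      (hZ : ∀ z (hs : z ≠ s) (hr : z ≠ r), ρ (.inr ⟨z, hs⟩) = ρ' (.inr ⟨z, hr⟩))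
      (hl : ρ (.inl ⟨p, hpq⟩) = ρ' (.inl ⟨q, hpq.symm⟩))
      (hr : ρ (.inr ⟨r, hrs⟩) = ρ' (.inr ⟨s, hrs.symm⟩))
      (he : edge (ρ (.inl ⟨p, hpq⟩)) (ρ (.inr ⟨r, hrs⟩))) :
      Interchange edge (C.map ρ (C.comp q s w w')) (C.map ρ' (C.comp p r w w'))

namespace Interchange

theorem symm {edge : X → X → Prop} {x x' : C.obj X} (h : Interchange edge x x') :
    Interchange edge x' x := by
  obtain ⟨p, q, r, s, hpq, hrs, w, w', ρ, ρ', hY, hZ, hl, hr, he⟩ := h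
  exact ⟨q, p, s, r, hpq.symm, hrs.symm, w, w', ρ', ρ, fun y h h' => (hY y h' h).symm,
    fun z h h' => (hZ z h' h).symm, hl.symm, hr.symm, by rwa [← hl, ← hr]⟩

theorem mono {edge edge' : X → X → Prop} {x x' : C.obj X} (h : Interchange edge x x')
    (hle : ∀ u v, edge u v → edge' u v) : Interchange edge' x x' := by
  obtain ⟨p, q, r, s, hpq, hrs, w, w', ρ, ρ', hY, hZ, hl, hr, he⟩ := h
  exact ⟨p, q, r, s, hpq, hrs, w, w', ρ, ρ', hY, hZ, hl, hr, hle _ _ he⟩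

/-- Here `z` is attached at a label `t` of `w'`. By associativity it can be absorbed into `w'`,
which leaves the four labels of the interchange untouched. -/
theorem comp_of_inr {a : X} {b : U} (z : C.obj U) {edge : Rest a ⊕ Rest b → Rest a ⊕ Rest b → Prop}
    (p q : Y) (r s t : Z) (hpq : p ≠ q) (hrs : r ≠ s) (hts : t ≠ s) (htr : t ≠ r) (w : C.obj Y)
    (w' : C.obj Z) (ρ : Rest q ⊕ Rest s ≃ X) (ρ' : Rest p ⊕ Rest r ≃ X)
    (hY : ∀ y (hq : y ≠ q) (hp : y ≠ p), ρ (.inl ⟨y, hq⟩) = ρ' (.inl ⟨y, hp⟩))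
    (hZ : ∀ z (hs : z ≠ s) (hr : z ≠ r), ρ (.inr ⟨z, hs⟩) = ρ' (.inr ⟨z, hr⟩))
    (hl : ρ (.inl ⟨p, hpq⟩) = ρ' (.inl ⟨q, hpq.symm⟩))
    (hr : ρ (.inr ⟨r, hrs⟩) = ρ' (.inr ⟨s, hrs.symm⟩))
    (ha : ρ (.inr ⟨t, hts⟩) = a)
    (he : ∀ h h', edge (.inl ⟨ρ (.inl ⟨p, hpq⟩), h⟩) (.inl ⟨ρ (.inr ⟨r, hrs⟩), h'⟩)) :
    Interchange edge (C.comp a b (C.map ρ (C.comp q s w w')) z)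
      (C.comp a b (C.map ρ' (C.comp p r w w')) z) := by
  have ha' : ρ' (.inr ⟨t, htr⟩) = a := by rw [← ha, hZ]
  have key : ∀ (q : Y) (s : Z) (hts : t ≠ s) (ρ : Rest q ⊕ Rest s ≃ X)
      (ha : ρ (.inr ⟨t, hts⟩) = a), C.comp a b (C.map ρ (C.comp q s w w')) z =
        C.map ((Relabel.assoc q s t b hts.symm).symm.trans
          (Equiv.sumCongr (Relabel.restTo ρ ha) (.refl _)))
          (C.comp q (.inl ⟨s, hts.symm⟩) w (C.comp t b w' z)) := by
    intro q s hts ρ ha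
    rw [C.comp_assoc q s t b hts.symm w w' z, ← C.map_trans, ← Equiv.trans_assoc,
      Equiv.self_trans_symm, Equiv.refl_trans, ← comp_map_left]
  rw [key q s hts ρ ha, key p r htr ρ' ha']
  refine .mk (Z := Rest t ⊕ Rest b) p q (.inl ⟨r, htr.symm⟩) (.inl ⟨s, hts.symm⟩) hpq
    (fun e => hrs (congrArg Subtype.val (Sum.inl.inj e))) w (C.comp t b w' z) _ _ ?_ ?_ ?_ ?_ ?_
  · exact fun y hq hp => congrArg Sum.inl (Subtype.ext (hY y hq hp))
  · rintro (y | y) hs hr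
    · exact congrArg Sum.inl (Subtype.ext (hZ y.1 (fun e => hs (congrArg _ (Subtype.ext e)))
        (fun e => hr (congrArg _ (Subtype.ext e)))))
    · rfl
  · exact congrArg Sum.inl (Subtype.ext hl)
  · exact congrArg Sum.inl (Subtype.ext hr)
  · exact he _ _

theorem comp {g : Gluing S X} {x x' : C.obj X} (h : Interchange g.edge x x') (g' : Gluing T U)
    (a : S) (b : T) (z : C.obj U) :
    Interchange (g.comp a b g').edge (C.comp (g.leg a) (g'.leg b) x z)
      (C.comp (g.leg a) (g'.leg b) x' z) := by
  obtain ⟨p, q, r, s, hpq, hrs, w, w', ρ, ρ', hY, hZ, hl, hr, he⟩ := h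
  obtain ⟨t, ht⟩ := ρ.surjective (g.leg a)
  rcases t with ⟨t, htq⟩ | ⟨t, hts⟩
  · have htp : t ≠ p := by rintro rfl; exact he.leg_ne a ht.symm
    -- The leg lies on `w`; commutativity exchanges the roles of `w` and `w'`.
    rw [C.comp_comm s q, C.comp_comm r p, ← C.map_trans, ← C.map_trans]
    exact comp_of_inr z r s p q t hrs hpq htq htp w' w ((Equiv.sumComm _ _).trans ρ)
      ((Equiv.sumComm _ _).trans ρ') hZ hY hr hl ht (fun _ _ => g.edge_symm he)
  · have htr : t ≠ r := by rintro rfl; exact (g.edge_symm he).leg_ne a ht.symm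
    exact comp_of_inr z p q r s t hpq hrs hts htr w w' ρ ρ' hY hZ hl hr ht (fun _ _ => he)

end Interchange

end CyclicOperad

/-! ### Glued elements and their moves -/

/-- An element of a cyclic operad together with a gluing of its labels. -/
structure GluedElt (C : CyclicOperad.{u}) (S : Type) : Type (max 1 u) where
  {carrier : Type}
  [finite : Finite carrier]
  val : C.obj carrier
  gluing : Gluing S carrier

namespace GluedElt

open CyclicOperad Relation

attribute [instance] GluedElt.finite

variable {C : CyclicOperad.{u}} {S T : Type}

def map (σ : S ≃ T) (n : GluedElt C S) : GluedElt C T := ⟨n.val, n.gluing.map σ⟩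

def contr (a b : S) (h : a ≠ b) (n : GluedElt C S) : GluedElt C (Rest₂ a b) :=
  ⟨n.val, n.gluing.contr a b h⟩

def comp (a : S) (b : T) (n : GluedElt C S) (k : GluedElt C T) : GluedElt C (Rest a ⊕ Rest b) :=
  ⟨C.comp (n.gluing.leg a) (k.gluing.leg b) n.val k.val, n.gluing.comp a b k.gluing⟩

/-- Elementary moves between glued elements: relabelling and interchange along an edge. -/
inductive Step : GluedElt C S → GluedElt C S → Prop
  | iso {X Y : Type} [Finite X] [Finite Y] (σ : X ≃ Y) (x : C.obj X) (g : Gluing S X)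
      (g' : Gluing S Y) (i : Gluing.IsIso σ g g') : Step ⟨x, g⟩ ⟨C.map σ x, g'⟩
  | interchange {X : Type} [Finite X] (x x' : C.obj X) (g : Gluing S X)
      (h : Interchange g.edge x x') : Step ⟨x, g⟩ ⟨x', g⟩

theorem Step.iso_of_eq {X Y : Type} [Finite X] [Finite Y] (σ : X ≃ Y) {x : C.obj X} {y : C.obj Y}
    {g : Gluing S X} {g' : Gluing S Y} (hy : y = C.map σ x) (i : Gluing.IsIso σ g g') :
    Step ⟨x, g⟩ ⟨y, g'⟩ := hy ▸ .iso σ x g g' i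

theorem Step.of_gluing {X : Type} [Finite X] {x : C.obj X} {g g' : Gluing S X}
    (hl : ∀ s, g'.leg s = g.leg s) (he : ∀ u v, g'.edge u v ↔ g.edge u v) :
    Step ⟨x, g⟩ ⟨x, g'⟩ := .iso_of_eq (.refl _) (C.map_refl _).symm ⟨hl, he⟩

theorem Step.map (σ : S ≃ T) {n k : GluedElt C S} (h : Step n k) : Step (n.map σ) (k.map σ) := by
  cases h with
  | iso τ x g g' i => exact .iso τ x _ _ ⟨fun s => i.leg _, i.edge⟩
  | interchange x x' g h => exact .interchange x x' _ h

theorem Step.contr (a b : S) (hab : a ≠ b) {n k : GluedElt C S} (h : Step n k) :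
    Step (n.contr a b hab) (k.contr a b hab) := by
  cases h with
  | iso τ x g g' i =>
    refine .iso τ x _ _ ⟨fun s => i.leg _, fun u v => ?_⟩
    simp [Gluing.contr, i.edge, i.leg]
  | interchange x x' g h => exact .interchange x x' _ (h.mono fun _ _ => .inl)

theorem Step.comp_comm (a : S) (b : T) (n : GluedElt C S) (k : GluedElt C T) :
    Step ((n.comp a b k).map (Equiv.sumComm _ _)) (k.comp b a n) := by
  refine .iso_of_eq (Equiv.sumComm _ _) (C.comp_comm _ _ _ _) ⟨?_, ?_⟩
  · rintro (s | s) <;> rfl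
  · rintro (u | u) (v | v) <;> exact .rfl

theorem Step.comp (a : S) (b : T) {n n' : GluedElt C S} (k : GluedElt C T) (h : Step n n') :
    Step (n.comp a b k) (n'.comp a b k) := by
  cases h with
  | iso τ x g g' i =>
    refine .iso_of_eq _ (comp_map_left τ (i.leg a).symm _ _ _) ⟨?_, ?_⟩
    · rintro (s | s)
      · exact congrArg Sum.inl (Subtype.ext (i.leg _))
      · rfl
    · rintro (u | u) (v | v)
      · exact i.edge u.1 v.1
      all_goals exact .rfl
  | interchange x x' g h => exact .interchange _ _ _ (h.comp k.gluing a b k.val)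

theorem eqvGen_map (σ : S ≃ T) {n k : GluedElt C S} (h : EqvGen Step n k) :
    EqvGen Step (n.map σ) (k.map σ) := by
  induction h with
  | rel _ _ h => exact .rel _ _ (h.map σ)
  | refl => exact .refl _
  | symm _ _ _ ih => exact ih.symm
  | trans _ _ _ _ _ ih ih' => exact ih.trans _ _ _ ih'

theorem eqvGen_contr (a b : S) (hab : a ≠ b) {n k : GluedElt C S} (h : EqvGen Step n k) :
    EqvGen Step (n.contr a b hab) (k.contr a b hab) := by
  induction h with
  | rel _ _ h => exact .rel _ _ (h.contr a b hab)
  | refl => exact .refl _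
  | symm _ _ _ ih => exact ih.symm
  | trans _ _ _ _ _ ih ih' => exact ih.trans _ _ _ ih'

theorem eqvGen_comp_left (a : S) (b : T) {n n' : GluedElt C S} (k : GluedElt C T)
    (h : EqvGen Step n n') : EqvGen Step (n.comp a b k) (n'.comp a b k) := by
  induction h with
  | rel _ _ h => exact .rel _ _ (h.comp a b k)
  | refl => exact .refl _
  | symm _ _ _ ih => exact ih.symm
  | trans _ _ _ _ _ ih ih' => exact ih.trans _ _ _ ih'

theorem eqvGen_comp (a : S) (b : T) {n n' : GluedElt C S} {k k' : GluedElt C T}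
    (h : EqvGen Step n n') (h' : EqvGen Step k k') :
    EqvGen Step (n.comp a b k) (n'.comp a b k') := by
  -- The second factor is changed by commuting it to the left and back.
  refine (eqvGen_comp_left a b k h).trans _ _ _ ?_
  refine (EqvGen.rel _ _ (Step.comp_comm b a k n')).symm.trans _ _ _ ?_
  refine .trans _ _ _ ?_ (EqvGen.rel _ _ (Step.comp_comm b a k' n'))
  exact eqvGen_map _ (eqvGen_comp_left b a n' h')

end GluedElt

/-! ### From formal expressions to glued elements -/

/-- Legs meet no edge, so swapping two of them does not affect the matching. -/
theorem Gluing.edge_swap_leg {S X : Type} [DecidableEq X] (g : Gluing S X) (a c : S) (u v : X) :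
    g.edge (Equiv.swap (g.leg a) (g.leg c) u) (Equiv.swap (g.leg a) (g.leg c) v) ↔ g.edge u v := by
  have h (s u) : ¬ g.edge u (g.leg s) := fun e => g.not_edge_leg _ _ (g.edge_symm e)
  simp only [Equiv.swap_apply_def]
  split_ifs <;> simp_all [g.not_edge_leg]

namespace ModWord

open CyclicOperad Relation GluedElt

variable {C : CyclicOperad.{u}}

/-- The glued element defined by a formal expression. -/
def glued : {S : Type} → [Finite S] → ModWord C S → GluedElt C S
  | S, _, gen x => ⟨x, Gluing.refl S⟩
  | _, _, map σ x => (glued x).map σ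
  | _, _, comp a b x y => (glued x).comp a b (glued y)
  | _, _, contr a b h x => (glued x).contr a b h

/-- The one defining relation that needs an interchange move. The two sides have different carriers,
so a relabelling comes first. -/
theorem glued_interchange {S T : Type} [Finite S] [Finite T] (a c : S) (b d : T)
    (hac : a ≠ c) (hbd : b ≠ d) (x : GluedElt C S) (y : GluedElt C T) :
    EqvGen Step
      ((x.comp a b y).contr (.inl ⟨c, hac.symm⟩) (.inr ⟨d, hbd.symm⟩) Sum.inl_ne_inr)
      (((x.comp c d y).contr (.inl ⟨a, hac⟩) (.inr ⟨b, hbd⟩) Sum.inl_ne_inr).map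
        (Relabel.interchange a c b d hac hbd)) := by
  classical
  obtain ⟨x, g⟩ := x
  obtain ⟨y, g'⟩ := y
  have hac' := g.leg_injective.ne hac
  have hbd' := g'.leg_injective.ne hbd
  -- Puts the labels left free by `a, b` composition, namely the legs of `c` and `d`, in the places
  -- of the legs of `a` and `b`.
  let ρ : Rest (g.leg a) ⊕ Rest (g'.leg b) ≃ Rest (g.leg c) ⊕ Rest (g'.leg d) :=
    Equiv.sumCongr (Relabel.restTo (Equiv.swap (g.leg a) (g.leg c)) (Equiv.swap_apply_left _ _))
      (Relabel.restTo (Equiv.swap (g'.leg b) (g'.leg d)) (Equiv.swap_apply_left _ _))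
  have hl : ρ (.inl ⟨g.leg c, hac'.symm⟩) = .inl ⟨g.leg a, hac'⟩ :=
    congrArg Sum.inl (Subtype.ext (Equiv.swap_apply_right _ _))
  have hr : ρ (.inr ⟨g'.leg d, hbd'.symm⟩) = .inr ⟨g'.leg b, hbd'⟩ :=
    congrArg Sum.inr (Subtype.ext (Equiv.swap_apply_right _ _))
  have hl' (z hc ha) : Sum.inl ⟨z, hc⟩ = ρ (.inl ⟨z, ha⟩) :=
    congrArg Sum.inl (Subtype.ext (Equiv.swap_apply_of_ne_of_ne ha hc).symm)
  have hr' (z hd hb) : Sum.inr ⟨z, hd⟩ = ρ (.inr ⟨z, hb⟩) :=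
    congrArg Sum.inr (Subtype.ext (Equiv.swap_apply_of_ne_of_ne hb hd).symm)
  let G := ((g.comp c d g').contr (.inl ⟨a, hac⟩) (.inr ⟨b, hbd⟩) Sum.inl_ne_inr).map
    (Relabel.interchange a c b d hac hbd)
  have hG : G.edge (.inl ⟨g.leg a, hac'⟩) (.inr ⟨g'.leg b, hbd'⟩) := Or.inr (Or.inl ⟨rfl, rfl⟩)
  refine .trans _ _ _ (.rel _ _ (.iso ρ _ _ G ⟨?_, ?_⟩)) ?_
  · rintro ⟨s | s, hs⟩
    · exact hl' _ _ _
    · exact hr' _ _ _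
  · intro u v
    refine or_congr ?_ (or_congr (and_congr ?_ ?_) (and_congr ?_ ?_))
    · rcases u with u | u <;> rcases v with v | v
      · exact g.edge_swap_leg a c u.1 v.1
      · exact .rfl
      · exact .rfl
      · exact g'.edge_swap_leg b d u.1 v.1
    all_goals first
      | exact ρ.injective.eq_iff' hl
      | exact ρ.injective.eq_iff' hr
  · refine .rel _ _ (.interchange _ _ _ (Interchange.symm ?_))
    have := Interchange.mk (edge := G.edge) _ _ _ _ hac' hbd' x y (.refl _) ρ hl' hr' hl.symm
      hr.symm hG
    rwa [C.map_refl] at this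

/-- Apart from `contr_interchange`, every axiom reduces to equality of glued elements, a
relabelling, or stability of the moves under the operations. -/
theorem Rel.glued {S : Type} [Finite S] {x y : ModWord C S} (h : Rel x y) :
    EqvGen Step x.glued y.glued := by
  induction h with
  | refl => exact .refl _
  | symm _ ih => exact ih.symm
  | trans _ _ ih₁ ih₂ => exact ih₁.trans _ _ _ ih₂
  | congr_map σ _ ih => exact eqvGen_map σ ih
  | congr_comp a b _ _ ih₁ ih₂ => exact eqvGen_comp a b ih₁ ih₂
  | congr_contr a b h _ ih => exact eqvGen_contr a b h ih
  | gen_map σ x =>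
    exact .symm _ _ (.rel _ _
      (.iso σ x _ _ ⟨fun s => (σ.apply_symm_apply s).symm, fun _ _ => .rfl⟩))
  | gen_comp a b x y =>
    refine .rel _ _ (.iso_of_eq (.refl _) (C.map_refl _).symm ⟨?_, ?_⟩)
    · rintro (s | s) <;> rfl
    · rintro (u | u) (v | v) <;> exact .rfl
  | map_refl => exact .refl _
  | map_trans => exact .refl _
  | comp_map σ τ a b x y =>
    -- Renaming the free labels leaves the carrier alone; only the rewriting of `σ.symm (σ a)` as
    -- `a` calls for a relabelling.
    refine .symm _ _ (.rel _ _ (.iso_of_eq _ (comp_of_eq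
      (congrArg x.glued.gluing.leg (σ.symm_apply_apply a).symm)
      (congrArg y.glued.gluing.leg (τ.symm_apply_apply b).symm) _ _) ⟨?_, ?_⟩))
    · rintro (s | s) <;> rfl
    · rintro (u | u) (v | v) <;> exact .rfl
  | comp_comm a b x y => exact .symm _ _ (.rel _ _ (Step.comp_comm a b x.glued y.glued))
  | comp_assoc a b c d h x y z =>
    refine .symm _ _ (.rel _ _ (.iso_of_eq _ (C.comp_assoc _ _ _ _
      (y.glued.gluing.leg_injective.ne h) _ _ _) ⟨?_, ?_⟩))
    · rintro (s | ⟨s | s, hs⟩) <;> rfl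
    · rintro (⟨u | u, hu⟩ | u) (⟨v | v, hv⟩ | v) <;> exact .rfl
  | contr_map σ a b h x =>
    refine .rel _ _ (.of_gluing (fun _ => rfl) fun u v => ?_)
    simp [ModWord.glued, GluedElt.map, GluedElt.contr, Gluing.map, Gluing.contr]
  | contr_comm a b h x =>
    exact .rel _ _ (.of_gluing (fun _ => rfl) fun u v => or_congr_right or_comm)
  | contr_contr a b c d hab hcd hca hcb hda hdb x =>
    exact .rel _ _ (.of_gluing (fun _ => rfl) fun u v => or_right_comm)
  | contr_interchange a c b d hac hbd x y => exact glued_interchange a c b d hac hbd _ _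
  | contr_comp a c d b hac had hcd x y =>
    refine .rel _ _ (.of_gluing ?_ ?_)
    · rintro ⟨s | s, hs⟩ <;> rfl
    · rintro (u | u) (v | v) <;>
      simp [ModWord.glued, GluedElt.contr, GluedElt.comp, Gluing.map, Gluing.contr,
        Gluing.comp, Gluing.sum, Gluing.rest, Subtype.ext_iff]

end ModWord

/-! ### The induced map on formal expressions -/

namespace ModWord

open CyclicOperad

/-- Apply a morphism of cyclic operads to the generators of a formal expression. -/
def push {C : CyclicOperad.{u}} {D : CyclicOperad.{v}} (F : C.Hom D) :
    {S : Type} → [Finite S] → ModWord C S → ModWord D S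
  | _, _, gen x => gen (F.app _ x)
  | _, _, map σ x => map σ (push F x)
  | _, _, comp a b x y => comp a b (push F x) (push F y)
  | _, _, contr a b h x => contr a b h (push F x)

theorem modMap_app_mk {C : CyclicOperad.{u}} {D : CyclicOperad.{v}} (𝕊 : Type w)
    [AddCommMonoidWithOne 𝕊] (F : C.Hom D) {S : Type} [Finite S] (x : ModWord C S) :
    (modMap 𝕊 F).app S (Quotient.mk _ x) = Quotient.mk _ (x.push F) := by
  change eval _ x = _
  induction x with
  | gen x => rfl
  | map σ x ih => exact congrArg (((D.modCompletion 𝕊).map σ)) ih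
  | comp a b x y ih₁ ih₂ => exact congrArg₂ ((D.modCompletion 𝕊).comp a b) ih₁ ih₂
  | contr a b h x ih => exact congrArg ((D.modCompletion 𝕊).contr a b h) ih

end ModWord

/-! ### Contraction of glued elements inside `Mod(B)` -/

namespace CyclicSuboperad

open CyclicOperad Relation

variable {C : CyclicOperad.{u}} (B : CyclicSuboperad C) (𝕊 : Type v) [AddCommMonoidWithOne 𝕊]

theorem map_mem_iff {S T : Type} [Finite S] [Finite T] (σ : S ≃ T) {x : C.obj S} :
    C.map σ x ∈ B.carrier T ↔ x ∈ B.carrier S := by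
  refine ⟨fun h => ?_, B.map_mem σ⟩
  have := B.map_mem σ.symm h
  rwa [← C.map_trans, Equiv.self_trans_symm, C.map_refl] at this

/-- An element of a suboperad as an element of its modular completion. -/
def toMod {X : Type} [Finite X] (x : C.obj X) (hx : x ∈ B.carrier X) :
    (B.toCyclicOperad.modCompletion 𝕊).obj X :=
  ((B.toCyclicOperad.modUnit 𝕊).app X ⟨x, hx⟩).1

theorem toMod_map {X Y : Type} [Finite X] [Finite Y] (σ : X ≃ Y) (x : C.obj X)
    (hx : x ∈ B.carrier X) : B.toMod 𝕊 (C.map σ x) (B.map_mem σ hx) =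
      (B.toCyclicOperad.modCompletion 𝕊).map σ (B.toMod 𝕊 x hx) :=
  congrArg Subtype.val ((B.toCyclicOperad.modUnit 𝕊).app_map σ ⟨x, hx⟩)

theorem toMod_comp {X Y : Type} [Finite X] [Finite Y] (a : X) (b : Y) (x : C.obj X) (y : C.obj Y)
    (hx : x ∈ B.carrier X) (hy : y ∈ B.carrier Y) :
    B.toMod 𝕊 (C.comp a b x y) (B.comp_mem a b hx hy) =
      (B.toCyclicOperad.modCompletion 𝕊).comp a b (B.toMod 𝕊 x hx) (B.toMod 𝕊 y hy) :=
  congrArg Subtype.val ((B.toCyclicOperad.modUnit 𝕊).app_comp a b ⟨x, hx⟩ ⟨y, hy⟩)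

/-- The glued element `n` lies in `B` and its contraction in `Mod(B)` is `m`. -/
def ContractsTo {S : Type} [Finite S] (n : GluedElt C S)
    (m : (B.toCyclicOperad.modCompletion 𝕊).obj S) : Prop :=
  ∃ h : n.val ∈ B.carrier n.carrier,
    (B.toCyclicOperad.modCompletion 𝕊).Contracts (B.toMod 𝕊 n.val h) n.gluing m

/-- Full contraction is compatible with relabelling, composition and contraction, so a class in
`Mod(B)` is recovered from its glued element. -/
theorem contractsTo_glued {S : Type} [Finite S] (x : ModWord B.toCyclicOperad S) :
    B.ContractsTo 𝕊 (x.push B.incl).glued (Quotient.mk _ x) := by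
  induction x with
  | gen x => exact ⟨x.2, .refl _⟩
  | map σ x ih => exact ⟨ih.1, ih.2.map σ⟩
  | comp a b x y ih₁ ih₂ =>
    refine ⟨B.comp_mem _ _ ih₁.1 ih₂.1, ?_⟩
    exact (B.toMod_comp 𝕊 _ _ _ _ ih₁.1 ih₂.1) ▸ ih₁.2.comp ih₂.2 a b
  | contr a b h x ih => exact ⟨ih.1, ih.2.contr a b h⟩

/-- The condition under which interchange moves do not leave a suboperad. -/
def InterchangeClosed : Prop :=
  ∀ (X Y : Type) [Finite X] [Finite Y] (p' q' : X) (p'' q'' : Y),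
    p' ≠ q' → p'' ≠ q'' → ∀ (w' : C.obj X) (w'' : C.obj Y),
    C.comp q' q'' w' w'' ∈ B.carrier (Rest q' ⊕ Rest q'') →
    (∃ ρ : Rest q' ⊕ Rest q'' ≃ Rest p' ⊕ Rest p'',
      (∀ (r : X) (hp : r ≠ p') (hq : r ≠ q'), ρ (Sum.inl ⟨r, hq⟩) = Sum.inl ⟨r, hp⟩) ∧
      (∀ (s : Y) (hp : s ≠ p'') (hq : s ≠ q''), ρ (Sum.inr ⟨s, hq⟩) = Sum.inr ⟨s, hp⟩) ∧
      C.comp p' p'' w' w'' = C.map ρ (C.comp q' q'' w' w'')) ∨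
    (∃ w₁' ∈ B.carrier X, ∃ w₁'' ∈ B.carrier Y,
      C.comp p' p'' w' w'' = C.comp p' p'' w₁' w₁'' ∧
      C.comp q' q'' w' w'' = C.comp q' q'' w₁' w₁'')

end CyclicSuboperad

/-! ### Invariance of the contraction under moves -/

/-- A permutation that only moves the two end points of an edge respects the gluing. -/
theorem Gluing.isIso_of_fixes {S X : Type} (g : Gluing S X) {u v : X} (h : g.edge u v)
    (θ : X ≃ X) (hθ : ∀ x, x ≠ u → x ≠ v → θ x = x) : IsIso θ g g := by
  have hmem : ∀ x, x = u ∨ x = v → θ x = u ∨ θ x = v := by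
    intro x hx
    by_contra! hn
    have := θ.injective (hθ (θ x) hn.1 hn.2)
    rcases hx with rfl | rfl
    · exact hn.1 this
    · exact hn.2 this
  -- At an end point the matching is described by the set `{u, v}` alone, which `θ` preserves.
  have pair : ∀ x y, (x = u ∨ x = v) → (g.edge x y ↔ (y = u ∨ y = v) ∧ y ≠ x) := by
    rintro x y (rfl | rfl)
    · constructor
      · exact fun e => ⟨.inr (g.edge_unique e h), e.ne.symm⟩
      · rintro ⟨rfl | rfl, hne⟩
        exacts [absurd rfl hne, h]
    · constructor
      · exact fun e => ⟨.inl (g.edge_unique e (g.edge_symm h)), e.ne.symm⟩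
      · rintro ⟨rfl | rfl, hne⟩
        exacts [g.edge_symm h, absurd rfl hne]
  have mem_iff : ∀ x, (θ x = u ∨ θ x = v) ↔ (x = u ∨ x = v) := by
    refine fun x => ⟨fun hx => ?_, hmem x⟩
    by_contra! hn
    rw [hθ x hn.1 hn.2] at hx
    exact hx.elim hn.1 hn.2
  refine ⟨fun s => (hθ _ (h.leg_ne s) ((g.edge_symm h).leg_ne s)).symm, fun x y => ?_⟩
  by_cases hx : x = u ∨ x = v
  · rw [pair _ _ hx, pair _ _ (hmem x hx), mem_iff, θ.injective.ne_iff]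
  by_cases hy : y = u ∨ y = v
  · have symm : ∀ a b, g.edge a b ↔ g.edge b a := fun _ _ => ⟨g.edge_symm, g.edge_symm⟩
    rw [symm x, symm (θ x), pair _ _ hy, pair _ _ (hmem y hy), mem_iff, θ.injective.ne_iff]
  · push Not at hx hy
    rw [hθ x hx.1 hx.2, hθ y hy.1 hy.2]

namespace CyclicSuboperad

open CyclicOperad Relation

variable {C : CyclicOperad.{u}} {B : CyclicSuboperad C} {𝕊 : Type v} [AddCommMonoidWithOne 𝕊]

/-- Contracting the edge of an interchange move gives the same result before and after. -/
theorem contr_toMod_interchange {X Y Z : Type} [Finite X] [Finite Y] [Finite Z] (p q : Y)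
    (r s : Z) (hpq : p ≠ q) (hrs : r ≠ s) (w : C.obj Y) (w' : C.obj Z) (hw : w ∈ B.carrier Y)
    (hw' : w' ∈ B.carrier Z) (ρ : Rest q ⊕ Rest s ≃ X) (ρ' : Rest p ⊕ Rest r ≃ X)
    (hY : ∀ y (hq : y ≠ q) (hp : y ≠ p), ρ (.inl ⟨y, hq⟩) = ρ' (.inl ⟨y, hp⟩))
    (hZ : ∀ z (hs : z ≠ s) (hr : z ≠ r), ρ (.inr ⟨z, hs⟩) = ρ' (.inr ⟨z, hr⟩))
    (u v : X) (huv : u ≠ v) (hu : ρ (.inl ⟨p, hpq⟩) = u) (hu' : ρ' (.inl ⟨q, hpq.symm⟩) = u)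
    (hv : ρ (.inr ⟨r, hrs⟩) = v) (hv' : ρ' (.inr ⟨s, hrs.symm⟩) = v) (h h') :
    (B.toCyclicOperad.modCompletion 𝕊).contr u v huv
        (B.toMod 𝕊 (C.map ρ (C.comp q s w w')) h) =
      (B.toCyclicOperad.modCompletion 𝕊).contr u v huv
        (B.toMod 𝕊 (C.map ρ' (C.comp p r w w')) h') := by
  set M := B.toCyclicOperad.modCompletion 𝕊
  rw [B.toMod_map 𝕊 ρ _ (B.comp_mem q s hw hw'), B.toMod_map 𝕊 ρ' _ (B.comp_mem p r hw hw'),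
    B.toMod_comp 𝕊 q s w w' hw hw', B.toMod_comp 𝕊 p r w w' hw hw']
  have key := M.contr_interchange p q r s hpq hrs (B.toMod 𝕊 w hw) (B.toMod 𝕊 w' hw')
  subst hu hv
  have e₁ := M.contr_map ρ _ _ (Sum.inl_ne_inr (a := ⟨p, hpq⟩) (b := ⟨r, hrs⟩))
    (M.comp q s (B.toMod 𝕊 w hw) (B.toMod 𝕊 w' hw'))
  -- The labels `u, v` are already fixed as images under `ρ`, so their description as images under
  -- `ρ'` must be used in generalised form.
  have e₂ : ∀ u v (huv : u ≠ v) (hu : ρ' (.inl ⟨q, hpq.symm⟩) = u)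
      (hv : ρ' (.inr ⟨s, hrs.symm⟩) = v),
      M.contr u v huv (M.map ρ' (M.comp p r (B.toMod 𝕊 w hw) (B.toMod 𝕊 w' hw'))) =
        M.map (ρ'.subtypeEquiv fun x => by simp [← hu, ← hv])
          (M.contr (.inl ⟨q, hpq.symm⟩) (.inr ⟨s, hrs.symm⟩) Sum.inl_ne_inr
            (M.comp p r (B.toMod 𝕊 w hw) (B.toMod 𝕊 w' hw'))) := by
    rintro _ _ huv rfl rfl
    exact M.contr_map ρ' _ _ Sum.inl_ne_inr _
  rw [e₂ _ _ huv hu' hv', key, ← M.map_trans]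
  refine e₁.trans (congrArg (fun σ => M.map σ _) (Equiv.ext ?_))
  rintro ⟨y | z, hy⟩
  · exact Subtype.ext (hY _ _ _)
  · exact Subtype.ext (hZ _ _ _)

/-- Only the composite is known to lie in `B`, not `w` and `w'`; the two alternatives of
`InterchangeClosed` make up for this. -/
theorem InterchangeClosed.contractsTo_of_interchange (hB : B.InterchangeClosed) {S X : Type}
    [Finite S] [Finite X] {x x' : C.obj X} {g : Gluing S X} (h : Interchange g.edge x x')
    {m : (B.toCyclicOperad.modCompletion 𝕊).obj S} (hm : B.ContractsTo 𝕊 ⟨x, g⟩ m) :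
    B.ContractsTo 𝕊 ⟨x', g⟩ m := by
  obtain ⟨p, q, r, s, hpq, hrs, w, w', ρ, ρ', hY, hZ, hl, hr, he⟩ := h
  obtain ⟨hx, k⟩ := hm
  have hx₀ := (B.map_mem_iff ρ).1 hx
  rcases hB _ _ p q r s hpq hrs w w' hx₀ with ⟨θ, hθY, hθZ, e⟩ | ⟨w₁, hw₁, w₁', hw₁', e, e'⟩
  -- Case (i): the move is a relabelling that fixes every label off the edge, hence an automorphism
  -- of the gluing.
  · have i : Gluing.IsIso (ρ.symm.trans (θ.trans ρ')) g g := by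
      refine g.isIso_of_fixes he _ fun a hu hv => ?_
      obtain ⟨a, rfl⟩ := ρ.surjective a
      rcases a with ⟨a, ha⟩ | ⟨a, ha⟩
      · have hp : a ≠ p := by rintro rfl; exact hu rfl
        rw [Equiv.trans_apply, Equiv.trans_apply, Equiv.symm_apply_apply, hθY a hp ha,
          hY a ha hp]
      · have hr : a ≠ r := by rintro rfl; exact hv rfl
        rw [Equiv.trans_apply, Equiv.trans_apply, Equiv.symm_apply_apply, hθZ a hr ha,
          hZ a ha hr]
    have hmap : C.map ρ' (C.comp p r w w') =
        C.map (ρ.symm.trans (θ.trans ρ')) (C.map ρ (C.comp q s w w')) := by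
      rw [e, ← C.map_trans, ← C.map_trans, ← Equiv.trans_assoc, Equiv.self_trans_symm,
        Equiv.refl_trans]
    rw [hmap]
    refine ⟨B.map_mem (x := C.map ρ (C.comp q s w w')) _ hx, ?_⟩
    rw [B.toMod_map 𝕊 _ _ hx]
    exact k.iso _ i
  -- Case (ii): `w₁` and `w₁'` lie in `B`. By uniqueness the contraction may begin with the edge of
  -- the move, after which both sides agree.
  · rw [e]
    have hx' := B.map_mem ρ' (B.comp_mem p r hw₁ hw₁')
    obtain ⟨m', k'⟩ := ModularOperad.Contracts.exists_contracts
      ((B.toCyclicOperad.modCompletion 𝕊).contr _ _ he.ne (B.toMod 𝕊 _ hx)) (g.remove _ _ he)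
    obtain rfl := k.unique (.step _ _ _ _ _ he k')
    refine ⟨hx', .step _ _ _ _ _ he ?_⟩
    convert k' using 1
    simp only [e']
    exact (contr_toMod_interchange p q r s hpq hrs w₁ w₁' hw₁ hw₁' ρ ρ' hY hZ _ _ he.ne rfl
      hl.symm rfl hr.symm _ _).symm

theorem InterchangeClosed.contractsTo_iff (hB : B.InterchangeClosed) {S : Type} [Finite S]
    {n n' : GluedElt C S} (h : EqvGen GluedElt.Step n n')
    (m : (B.toCyclicOperad.modCompletion 𝕊).obj S) :
    B.ContractsTo 𝕊 n m ↔ B.ContractsTo 𝕊 n' m := by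
  induction h with
  | refl => exact .rfl
  | symm _ _ _ ih => exact ih.symm
  | trans _ _ _ _ _ ih ih' => exact ih.trans ih'
  | rel _ _ h =>
    cases h with
    | interchange x x' g h =>
      exact ⟨hB.contractsTo_of_interchange h, hB.contractsTo_of_interchange h.symm⟩
    | iso σ x g g' i =>
      constructor
      · rintro ⟨hx, k⟩
        exact ⟨B.map_mem σ hx, (B.toMod_map 𝕊 σ x hx) ▸ k.iso σ i⟩
      · rintro ⟨hx, k⟩
        have hx₀ := (B.map_mem_iff σ).1 hx
        -- Backwards along a relabelling: contract `x` to some `m'`, transport along `σ`, and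
        -- conclude `m' = m` by uniqueness.
        obtain ⟨m', k'⟩ := ModularOperad.Contracts.exists_contracts (B.toMod 𝕊 x hx₀) g
        have k'' := k'.iso σ i
        rw [← B.toMod_map 𝕊 σ x hx₀] at k''
        obtain rfl := k.unique k''
        exact ⟨hx₀, k'⟩

end CyclicSuboperad
-- Injectivity of the induced map
/-- The sets `{p', q'} ⊔ R` and `{p'', q''} ⊔ S` are `X` and `Y`: finite sets with two chosen
distinct elements. -/
theorem mainTheorem3 {𝕊 : Type v} [AddCommMonoidWithOne 𝕊] [CharZero 𝕊]
    (C : CyclicOperad.{u}) (B : CyclicSuboperad C)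
    (hB : ∀ (X Y : Type) [Finite X] [Finite Y] (p' q' : X) (p'' q'' : Y),
      p' ≠ q' → p'' ≠ q'' → ∀ (w' : C.obj X) (w'' : C.obj Y),
      C.comp q' q'' w' w'' ∈ B.carrier (Rest q' ⊕ Rest q'') →
      (∃ ρ : Rest q' ⊕ Rest q'' ≃ Rest p' ⊕ Rest p'',
        (∀ (r : X) (hp : r ≠ p') (hq : r ≠ q'), ρ (Sum.inl ⟨r, hq⟩) = Sum.inl ⟨r, hp⟩) ∧
        (∀ (s : Y) (hp : s ≠ p'') (hq : s ≠ q''), ρ (Sum.inr ⟨s, hq⟩) = Sum.inr ⟨s, hp⟩) ∧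
        C.comp p' p'' w' w'' = C.map ρ (C.comp q' q'' w' w'')) ∨
      (∃ w₁' ∈ B.carrier X, ∃ w₁'' ∈ B.carrier Y,
        C.comp p' p'' w' w'' = C.comp p' p'' w₁' w₁'' ∧
        C.comp q' q'' w' w'' = C.comp q' q'' w₁' w₁'')) :
    ∀ (S : Type) [Finite S],
      Function.Injective ((CyclicOperad.modMap 𝕊 B.incl).app S) := by
  rintro S _ ⟨x⟩ ⟨y⟩ h
  have h' : (Quotient.mk _ (x.push B.incl) : (C.modCompletion 𝕊).obj S) =
      Quotient.mk _ (y.push B.incl) :=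
    (ModWord.modMap_app_mk 𝕊 B.incl x).symm.trans (h.trans (ModWord.modMap_app_mk 𝕊 B.incl y))
  have hB' : B.InterchangeClosed := hB
  -- The glued element of `y` contracts in `Mod(B)` both to the class of `x`, transported along the
  -- moves, and to the class of `y`.
  exact ((hB'.contractsTo_iff (Quotient.exact h').glued _).1 (B.contractsTo_glued 𝕊 x)).2.unique
    (B.contractsTo_glued 𝕊 y).2
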